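/- Let $T$ be a commutative ring, $R$ a nonzero associative unital $T$-algebra, and $X$ a locally finite preordered set (every $[x,y]=\{z: x\le z\le y\}$ is finite). Write $x\sim y$ if $x\le y\le x$, $[x]=\{y: y\sim x\}$ and $n_x=|[x]|$. Let $K=I(X,R)$ be the incidence algebra: the $T$-algebra of all $f:X\times X\to R$ with $f(x,y)=0$ whenever $x\not\le y$, with pointwise addition and $T$-action and product $(fg)(x,y)=\sum_{x\le z\le y}f(x,z)g(z,y)$. All automorphisms and isomorphisms of algebras are $T$-algebra ones; for an algebra $A$, $\mathrm{In}(\mathrm{Aut}\,A)$ is the group of inner automorphisms and $\mathrm{Out}\,A=\mathrm{Aut}\,A/\mathrm{In}(\mathrm{Aut}\,A)$. Notation. $L=\{f\in K: f(x,y)=0 \text{ if } x\not\sim y\}$ and $M=\{f\in K: f(x,y)=0\text{ if }x\sim y\}$, so that $K=L\oplus M$; $e_x\in L$ is given by $e_x(y,y)=1$ for $y\in[x]$ and $e_x(z,y)=0$ for all other pairs $(z,y)$; $R_x=e_xKe_x$ (isomorphic to the matrix algebra $M(n_x,R)$). * $\mathrm{In}_1(\mathrm{Aut}\,K)$ and $\mathrm{In}_0(\mathrm{Aut}\,K)$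 are the groups of inner automorphisms of $K$ defined by invertible elements $1+d$ with $d\in M$, respectively by invertible elements of $L$. * $\Lambda$ is the group of $\varphi\in\mathrm{Aut}\,K$ with $\varphi L=L$ and $\varphi M=M$; $C=\{\varphi\in\Lambda: \varphi R_x=R_x \text{ for all } x\}$; $\Psi=\{\varphi\in\Lambda: \varphi|_L=1\}$; $\Psi_0$ is the group of inner automorphisms of $K$ defined by invertible central elements of $L$; $\mathrm{Out}_0K=C/\mathrm{In}_0(\mathrm{Aut}\,K)$. * For $\varphi\in\mathrm{Aut}\,K$ with $\varphi M=M$ let $f(\varphi)\in\mathrm{Aut}\,L$ send $a$ to the $L$-component of $\varphi(a)$. Let $\Omega$ be the image of $f$ and $\Omega_1=\{\alpha\in\Omega:\alpha R_x=R_x\text{ for all }x\}$. * $\mathrm{In}(\mathrm{Aut}\,X)$ is the group of automorphisms of the preordered set $X$ that map every $[x]$ into itself, and $\mathrm{Out}\,X=\mathrm{Aut}\,X/\mathrm{In}(\mathrm{Aut}\,X)$. $\mathrm{Aut}\,X$ acts on $K$ by $(\tau g)(x,y)=g(\tau^{-1}x,\tau^{-1}y)$. Assume Condition (II): for all $\varphi\in\mathrm{Aut}\,K$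 and $x\in X$ there is $y\in X$ with $\varphi(e_x)\in e_y+M$. Assume also at least one of (1) for all $x,y\in X$, $R_x\cong R_y$ implies $n_x=n_y$; (2) (the $(n,m)$-condition) for all positive integers $n,m$, $M(n,R)\cong M(m,R)$ implies $n=m$. Then the projection $\mathrm{Aut}\,X\to\mathrm{Out}\,X$ has a homomorphic section, and for every such section $s$ the following hold. **a.** The maps $\mathrm{Out}\,X\to\mathrm{Aut}\,K$ and $\mathrm{Out}\,X\to\mathrm{Aut}\,L$ obtained from $s$, the action of $\mathrm{Aut}\,X$ on $K$, and (for the second) $f$ are injective. Identifying $\mathrm{Out}\,X$ with its images, one has internal semidirect decompositions (normal factors on the left) $$\Omega=\Omega_1\rtimes\mathrm{Out}\,X,\qquad \Lambda=C\rtimes\mathrm{Out}\,X,\qquad \mathrm{Aut}\,K=\mathrm{In}_1(\mathrm{Aut}\,K)\rtimes C\rtimes\mathrm{Out}\,X,$$ the last one with either bracketing. **b.** 1. $\mathrm{Out}\,K\cong\mathrm{Out}_0K\rtimes\mathrm{Out}\,X$. Moreover $\mathrm{Out}_0K$ has a normal subgroup $F$ with $F\cong\Psi/\Psi_0$ and $(\mathrm{Out}_0K)/F\cong\Omega_1/\mathrm{In}(\mathrm{Aut}\,L)$.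 2. If $\Psi=\Psi_0$, then $\mathrm{Out}\,K\cong\Omega_1/\mathrm{In}(\mathrm{Aut}\,L)\rtimes\mathrm{Out}\,X$. 3. If $\Omega_1=\mathrm{In}(\mathrm{Aut}\,L)$, then $\mathrm{Out}\,K\cong\Psi/\Psi_0\rtimes\mathrm{Out}\,X$. In the three isomorphisms with $\mathrm{Out}\,K$, the class of the automorphism of $K$ attached to $q\in\mathrm{Out}\,X$ corresponds to $q$, and the class of $c\in C$ corresponds to the class of $c$ in 1 and to the class of $f(c)$ in 2, while in 3 the class of $\psi\in\Psi$ corresponds to the class of $\psi$. -/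

import Mathlib

open scoped Pointwise

noncomputable section

set_option linter.unusedSectionVars false

/-! ## General group and algebra notions -/

/-- `G = N ⋊ H` as an internal semidirect product of subgroups of an ambient group `A`:
`N` is normal in `G`, `N ∩ H = 1` and `G = N H`. -/
structure IsInternalSemidirect {A : Type*} [Group A] (G N H : Subgroup A) : Prop where
  left_le : N ≤ G
  right_le : H ≤ G
  normal : (N.subgroupOf G).Normal
  inf_eq_bot : N ⊓ H = ⊥
  mul_eq : (N : Set A) * (H : Set A) = (G : Set A)

section General

variable (T : Type*) [CommRing T] {A : Type*} [Ring A] [Algebra T A]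

/-- The group of those automorphisms `φ` of the `T`-algebra `A` with `φ S = S`. -/
def autPreserving (S : Set A) : Subgroup (A ≃ₐ[T] A) where
  carrier := {φ | φ '' S = S}
  one_mem' := Set.image_id S
  mul_mem' := by
    intro φ ψ (hφ : φ '' S = S) (hψ : ψ '' S = S)
    change (fun a => φ (ψ a)) '' S = S
    rw [← Set.image_image φ ψ S, hψ, hφ]
  inv_mem' := by
    intro φ (hφ : φ '' S = S)
    change φ.symm '' S = S
    conv_lhs => rw [← hφ]
    rw [Set.image_image]
    simp

theorem mem_autPreserving {S : Set A} {φ : A ≃ₐ[T] A} :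
    φ ∈ autPreserving T S ↔ φ '' S = S := Iff.rfl

variable {T} in
theorem autPreserving_mem {S : Set A} {φ : A ≃ₐ[T] A} (h : φ ∈ autPreserving T S)
    {a : A} (ha : a ∈ S) : φ a ∈ S := by
  rw [mem_autPreserving] at h
  rw [← h]
  exact ⟨a, ha, rfl⟩

/-- The inner automorphism `a ↦ u a u⁻¹` of the `T`-algebra `A`. -/
def innerAut : Aˣ →* (A ≃ₐ[T] A) where
  toFun u :=
    AlgEquiv.ofAlgHom
      (AlgHom.ofLinearMap
        { toFun := fun a => u * a * (u⁻¹ : Aˣ)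
          map_add' := fun a b => by rw [mul_add, add_mul]
          map_smul' := fun t a => by simp }
        (by simp)
        (fun a b => by simp [mul_assoc]))
      (AlgHom.ofLinearMap
        { toFun := fun a => (u⁻¹ : Aˣ) * a * u
          map_add' := fun a b => by rw [mul_add, add_mul]
          map_smul' := fun t a => by simp }
        (by simp)
        (fun a b => by simp [mul_assoc]))
      (by ext a; simp [mul_assoc])
      (by ext a; simp [mul_assoc])
  map_one' := by ext a; simp
  map_mul' u v := by ext a; simp [mul_assoc]

@[simp] theorem innerAut_apply (u : Aˣ) (a : A) :
    innerAut T u a = u * a * (u⁻¹ : Aˣ) := rfl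

theorem conj_innerAut (φ : A ≃ₐ[T] A) (u : Aˣ) :
    φ * innerAut T u * φ⁻¹ = innerAut T (Units.map (φ : A →* A) u) := by
  ext a
  have h : φ (φ⁻¹ a) = a := φ.apply_symm_apply a
  change φ (u * φ⁻¹ a * (u⁻¹ : Aˣ)) = φ u * a * φ (u⁻¹ : Aˣ)
  rw [map_mul, map_mul, h]

variable (A)

/-- `In(Aut A)`, the group of inner automorphisms of the `T`-algebra `A`. -/
def Inn : Subgroup (A ≃ₐ[T] A) := (innerAut T (A := A)).range

instance Inn_normal : (Inn T A).Normal where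
  conj_mem := by
    rintro _ ⟨u, rfl⟩ φ
    rw [conj_innerAut]
    exact ⟨_, rfl⟩

/-- `Out A = Aut A / In(Aut A)`. -/
abbrev OutAlg : Type _ := (A ≃ₐ[T] A) ⧸ Inn T A

end General

/-! ## Automorphisms of a preordered set -/

section Order

variable (X : Type*) [Preorder X]

/-- `In(Aut X)`: the automorphisms of the preordered set `X` that map every interval
`[x] = [x, x]` into itself. -/
def InnOrd : Subgroup (X ≃o X) where
  carrier := {τ | ∀ x, Set.MapsTo τ (Set.Icc x x) (Set.Icc x x)}
  one_mem' := fun _ _ h => h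
  mul_mem' := fun hσ hτ x _ h => hσ x (hτ x h)
  inv_mem' := by
    intro τ hτ x y hy
    have h := hτ (τ⁻¹ y) (Set.left_mem_Icc.2 le_rfl)
    have e : τ (τ⁻¹ y) = y := τ.apply_symm_apply y
    rw [e] at h
    exact ⟨hy.1.trans h.2, h.1.trans hy.2⟩

instance InnOrd_normal : (InnOrd X).Normal where
  conj_mem := by
    intro τ hτ σ x y hy
    have h := hτ (σ⁻¹ y) (Set.left_mem_Icc.2 le_rfl)
    have e : σ (σ⁻¹ y) = y := σ.apply_symm_apply y
    have h1 := σ.monotone h.1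
    have h2 := σ.monotone h.2
    rw [e] at h1 h2
    exact ⟨hy.1.trans h1, h2.trans hy.2⟩

/-- `Out X = Aut X / In(Aut X)`. -/
abbrev OutOrd : Type _ := (X ≃o X) ⧸ InnOrd X

variable {X}

/-- `s` embeds `Out X` in `Aut X` as a complement of `In(Aut X)`, i.e. `s` is a homomorphic
section of the projection `Aut X → Out X`; equivalently, `Aut X = In(Aut X) ⋊ s(Out X)`
compatibly with the projection. -/
def IsOutSection (s : OutOrd X →* (X ≃o X)) : Prop :=
  ∀ q : OutOrd X, (QuotientGroup.mk (s q) : OutOrd X) = q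

end Order

/-! ## The incidence algebra `K = I(X, R)` over the commutative ring `T` -/

namespace IncAut

section Defs

variable (T R X : Type*) [CommRing T] [Ring R] [Algebra T R]
  [Preorder X] [LocallyFiniteOrder X] [DecidableEq X]

/-- The pointwise `T`-algebra structure on the incidence algebra. -/
instance instAlgebraIncidence : Algebra T (IncidenceAlgebra R X) :=
  Algebra.ofModule
    (fun t f g => by
      ext a b _
      simp [IncidenceAlgebra.constSMul_apply, Finset.smul_sum])
    (fun t f g => by
      ext a b _
      simp [IncidenceAlgebra.constSMul_apply, Finset.smul_sum])

/-- The automorphism group of the `T`-algebra `K = I(X, R)`. -/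
abbrev AutK : Type _ := IncidenceAlgebra R X ≃ₐ[T] IncidenceAlgebra R X

/-- `x ∼ y`, i.e. `x ≤ y` and `y ≤ x`. -/
abbrev Equi {X : Type*} [Preorder X] (x y : X) : Prop := AntisymmRel (· ≤ ·) x y

/-- The subalgebra `L = {f ∈ K | f(x, y) = 0 if x ≁ y}`. -/
def L : Subalgebra T (IncidenceAlgebra R X) where
  carrier := {f | ∀ x y, ¬ Equi x y → f x y = 0}
  mul_mem' := by
    intro f g hf hg x y hxy
    rw [IncidenceAlgebra.mul_apply]
    refine Finset.sum_eq_zero fun z _ => ?_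
    by_cases h : Equi x z
    · rw [hg z y fun h' => hxy (AntisymmRel.trans h h'), mul_zero]
    · rw [hf x z h, zero_mul]
  add_mem' := by
    intro f g hf hg x y hxy
    simp [IncidenceAlgebra.add_apply, hf x y hxy, hg x y hxy]
  algebraMap_mem' := by
    intro t x y hxy
    have h : x ≠ y := fun h => hxy (h ▸ AntisymmRel.rfl)
    simp [Algebra.algebraMap_eq_smul_one, IncidenceAlgebra.constSMul_apply, h]

/-- The ideal `M = {f ∈ K | f(x, y) = 0 if x ∼ y}`, as a `T`-submodule of `K`. -/
def M : Submodule T (IncidenceAlgebra R X) where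
  carrier := {f | ∀ x y, Equi x y → f x y = 0}
  zero_mem' := fun _ _ _ => rfl
  add_mem' := by
    intro f g hf hg x y hxy
    simp [IncidenceAlgebra.add_apply, hf x y hxy, hg x y hxy]
  smul_mem' := by
    intro t f hf x y hxy
    simp [IncidenceAlgebra.constSMul_apply, hf x y hxy]

variable {X} in
/-- The subalgebra `R_x = {f ∈ K | f(z, y) = 0 if z ≁ x or y ≁ x}`
(its identity element is `e_x`, so it is not a unital subalgebra of `K`). -/
def Rx (x : X) : NonUnitalSubalgebra T (IncidenceAlgebra R X) where
  carrier := {f | ∀ z y, ¬ Equi z x ∨ ¬ Equi y x → f z y = 0}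
  zero_mem' := fun _ _ _ => rfl
  add_mem' := by
    intro f g hf hg z y h
    simp [IncidenceAlgebra.add_apply, hf z y h, hg z y h]
  smul_mem' := by
    intro t f hf z y h
    simp [IncidenceAlgebra.constSMul_apply, hf z y h]
  mul_mem' := by
    intro f g hf hg z y h
    rw [IncidenceAlgebra.mul_apply]
    refine Finset.sum_eq_zero fun w _ => ?_
    rcases h with h | h
    · rw [hf z w (Or.inl h), zero_mul]
    · rw [hg w y (Or.inr h), mul_zero]

variable {X} in
/-- The idempotent `e_x = e_{[x]}`. -/
def e (x : X) : IncidenceAlgebra R X where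
  toFun a b := if a = b ∧ a ∈ Finset.Icc x x then 1 else 0
  eq_zero_of_not_le' := fun _ _ h => if_neg fun h' => h h'.1.le

/-- Condition (II): for every `φ ∈ Aut K` and `x ∈ X`, `φ(e_x) ∈ e_y + M` for some `y`. -/
def ConditionII : Prop :=
  ∀ (φ : AutK T R X) (x : X), ∃ y : X, φ (e R x) - e R y ∈ M T R X

variable {X} in
/-- `R_x ≅ R_y` as `T`-algebras. -/
def RxIso (x y : X) : Prop :=
  ∃ i : Rx T R x ≃+* Rx T R y, ∀ (t : T) (a : Rx T R x), i (t • a) = t • i a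

/-- The order `n_x = |[x]|` of the matrices in `R_x ≅ M(n_x, R)`. -/
def nx {X : Type*} [Preorder X] [LocallyFiniteOrder X] (x : X) : ℕ := (Finset.Icc x x).card

/-- `R_x ≅ R_y` implies `n_x = n_y`, for all `x, y ∈ X`. -/
def ConditionOne : Prop := ∀ x y : X, RxIso T R x y → nx x = nx y

/-- The `(n, m)`-condition on `R`: `M(n, R) ≅ M(m, R)` implies `n = m`. -/
def NMCondition (T R : Type*) [CommRing T] [Ring R] [Algebra T R] : Prop :=
  ∀ n m : ℕ, 0 < n → 0 < m →
    Nonempty (Matrix (Fin n) (Fin n) R ≃ₐ[T] Matrix (Fin m) (Fin m) R) → n = m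

/-! ### Subgroups of `Aut K` -/

/-- The triangular automorphisms: those with `φ M = M`. -/
def Tri : Subgroup (AutK T R X) := autPreserving T (M T R X : Set (IncidenceAlgebra R X))

/-- `Λ`, the diagonal automorphisms: those with `φ L = L` and `φ M = M`. -/
def Lam : Subgroup (AutK T R X) :=
  autPreserving T (L T R X : Set (IncidenceAlgebra R X)) ⊓ Tri T R X

/-- `C`, the diagonal automorphisms with `φ R_x = R_x` for every `x`. -/
def C : Subgroup (AutK T R X) :=
  Lam T R X ⊓ ⨅ x : X, autPreserving T (Rx T R x : Set (IncidenceAlgebra R X))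

/-- `Ψ`, the diagonal automorphisms that are the identity on `L`. -/
def Psi : Subgroup (AutK T R X) where
  carrier := {φ | φ ∈ Lam T R X ∧ ∀ a ∈ L T R X, φ a = a}
  one_mem' := ⟨one_mem _, fun _ _ => rfl⟩
  mul_mem' := by
    rintro φ ψ ⟨h1, h2⟩ ⟨h3, h4⟩
    refine ⟨mul_mem h1 h3, fun a ha => ?_⟩
    rw [AlgEquiv.mul_apply, h4 a ha, h2 a ha]
  inv_mem' := by
    rintro φ ⟨h1, h2⟩
    refine ⟨inv_mem h1, fun a ha => ?_⟩
    change φ.symm a = a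
    rw [AlgEquiv.symm_apply_eq, h2 a ha]

/-- The inclusion of the units of `L` into the units of `K`. -/
def unitsIncl : (L T R X)ˣ →* (IncidenceAlgebra R X)ˣ :=
  Units.map ((L T R X).val : L T R X →* IncidenceAlgebra R X)

theorem mul_mem_M_right {f g : IncidenceAlgebra R X} (hf : f ∈ M T R X) : f * g ∈ M T R X := by
  intro x y hxy
  rw [IncidenceAlgebra.mul_apply]
  refine Finset.sum_eq_zero fun z hz => ?_
  have hz := Finset.mem_Icc.1 hz
  rw [hf x z ⟨hz.1, hz.2.trans hxy.2⟩, zero_mul]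

theorem mul_mem_M_left {f g : IncidenceAlgebra R X} (hg : g ∈ M T R X) : f * g ∈ M T R X := by
  intro x y hxy
  rw [IncidenceAlgebra.mul_apply]
  refine Finset.sum_eq_zero fun z hz => ?_
  have hz := Finset.mem_Icc.1 hz
  rw [hg z y ⟨hz.2, hxy.2.trans hz.1⟩, mul_zero]

/-- The units of `K` of the form `1 + d`, `d ∈ M`. -/
def unitsOne : Subgroup (IncidenceAlgebra R X)ˣ where
  carrier := {u | (u : IncidenceAlgebra R X) - 1 ∈ M T R X}
  one_mem' := by simp
  mul_mem' := by
    intro u v (hu : (u : IncidenceAlgebra R X) - 1 ∈ M T R X)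
      (hv : (v : IncidenceAlgebra R X) - 1 ∈ M T R X)
    have h : ((u * v : (IncidenceAlgebra R X)ˣ) : IncidenceAlgebra R X) - 1 =
        (u - 1) * v + (v - 1) := by
      rw [Units.val_mul, sub_mul, one_mul]; abel
    change _ ∈ M T R X
    rw [h]
    exact add_mem (mul_mem_M_right T R X hu) hv
  inv_mem' := by
    intro u (hu : (u : IncidenceAlgebra R X) - 1 ∈ M T R X)
    have h : ((u⁻¹ : (IncidenceAlgebra R X)ˣ) : IncidenceAlgebra R X) - 1 =
        -((u⁻¹ : (IncidenceAlgebra R X)ˣ) * ((u : IncidenceAlgebra R X) - 1)) := by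
      rw [mul_sub, Units.inv_mul, mul_one, neg_sub]
    change _ ∈ M T R X
    rw [h]
    exact neg_mem (mul_mem_M_left T R X hu)

/-- `In_1(Aut K)`: inner automorphisms defined by invertible elements `1 + d`, `d ∈ M`. -/
def In1 : Subgroup (AutK T R X) := (unitsOne T R X).map (innerAut T)

/-- `In_0(Aut K)`: inner automorphisms of `K` defined by invertible elements of `L`. -/
def In0 : Subgroup (AutK T R X) := (unitsIncl T R X).range.map (innerAut T)

/-- `Ψ_0`: inner automorphisms of `K` defined by invertible central elements of `L`. -/
def Psi0 : Subgroup (AutK T R X) :=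
  ((Submonoid.center (L T R X)).units.map (unitsIncl T R X)).map (innerAut T)

theorem conj_mem_In0 {φ g : AutK T R X} (hφ : φ ∈ C T R X) (hg : g ∈ In0 T R X) :
    φ * g * φ⁻¹ ∈ In0 T R X := by
  obtain ⟨_, ⟨v, rfl⟩, rfl⟩ := Subgroup.mem_map.1 hg
  have hL : ∀ a ∈ L T R X, φ a ∈ L T R X := fun a ha => autPreserving_mem hφ.1.1 ha
  have h1 : φ (v : L T R X) * φ (v⁻¹ : (L T R X)ˣ) = 1 := by
    rw [← map_mul, ← MulMemClass.coe_mul, Units.mul_inv, OneMemClass.coe_one, map_one]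
  have h2 : φ (v⁻¹ : (L T R X)ˣ) * φ (v : L T R X) = 1 := by
    rw [← map_mul, ← MulMemClass.coe_mul, Units.inv_mul, OneMemClass.coe_one, map_one]
  let w : (L T R X)ˣ :=
    ⟨⟨φ (v : L T R X), hL _ v.1.2⟩, ⟨φ (v⁻¹ : (L T R X)ˣ), hL _ (v⁻¹ : (L T R X)ˣ).1.2⟩,
      Subtype.ext h1, Subtype.ext h2⟩
  have hw : Units.map (φ : IncidenceAlgebra R X →* IncidenceAlgebra R X) (unitsIncl T R X v) =
      unitsIncl T R X w := Units.ext rfl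
  rw [conj_innerAut, hw]
  exact Subgroup.mem_map_of_mem _ ⟨w, rfl⟩

instance In0_normal : ((In0 T R X).subgroupOf (C T R X)).Normal where
  conj_mem := fun _ hg φ => conj_mem_In0 T R X φ.2 hg

theorem conj_mem_Psi0 {φ g : AutK T R X} (hφ : φ ∈ Psi T R X) (hg : g ∈ Psi0 T R X) :
    φ * g * φ⁻¹ ∈ Psi0 T R X := by
  obtain ⟨_, hu, rfl⟩ := Subgroup.mem_map.1 hg
  obtain ⟨v, hv, rfl⟩ := Subgroup.mem_map.1 hu
  have hw : Units.map (φ : IncidenceAlgebra R X →* IncidenceAlgebra R X) (unitsIncl T R X v) =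
      unitsIncl T R X v := Units.ext (hφ.2 _ v.1.2)
  rw [conj_innerAut, hw]
  exact hg

instance Psi0_normal : ((Psi0 T R X).subgroupOf (Psi T R X)).Normal where
  conj_mem := fun _ hg φ => conj_mem_Psi0 T R X φ.2 hg

/-- `Out_0 K = C / In_0(Aut K)`. -/
abbrev Out0 : Type _ := C T R X ⧸ (In0 T R X).subgroupOf (C T R X)

/-- `Ψ / Ψ_0`. -/
abbrev PsiQuot : Type _ := Psi T R X ⧸ (Psi0 T R X).subgroupOf (Psi T R X)

/-! ### The homomorphism `f`, `φ = (α 0; δ β) ↦ α`, and subgroups of `Aut L` -/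

open scoped Classical in
/-- The projection of `K = L ⊕ M` onto `L`, an algebra homomorphism. -/
def projL : IncidenceAlgebra R X →ₐ[T] L T R X :=
  AlgHom.ofLinearMap
    { toFun := fun f =>
        ⟨⟨fun a b => if Equi a b then f a b else 0, fun a b h => if_neg fun h' => h h'.1⟩,
          fun _ _ h => if_neg h⟩
      map_add' := by
        intro f g
        ext a b _
        change (if Equi a b then f a b + g a b else 0) =
          (if Equi a b then f a b else 0) + (if Equi a b then g a b else 0)
        split_ifs <;> simp
      map_smul' := by
        intro t f
        ext a b _
        change (if Equi a b then t • f a b else 0) = t • (if Equi a b then f a b else 0)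
        split_ifs <;> simp }
    (by
      ext a b _
      change (if Equi a b then (if a = b then (1 : R) else 0) else 0) = if a = b then 1 else 0
      split_ifs with h1 h2 h3 <;> first | rfl | exact absurd (h3 ▸ AntisymmRel.rfl) h1)
    (by
      intro f g
      ext a b _
      change (if Equi a b then ∑ z ∈ Finset.Icc a b, f a z * g z b else 0) =
        ∑ z ∈ Finset.Icc a b, (if Equi a z then f a z else 0) * (if Equi z b then g z b else 0)
      split_ifs with h
      · refine Finset.sum_congr rfl fun z hz => ?_
        have hz := Finset.mem_Icc.1 hz
        rw [if_pos ⟨hz.1, hz.2.trans h.2⟩, if_pos ⟨hz.2, h.2.trans hz.1⟩]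
      · refine (Finset.sum_eq_zero fun z _ => ?_).symm
        by_cases h1 : Equi a z
        · rw [if_neg fun h2 => h (AntisymmRel.trans h1 h2), mul_zero]
        · rw [if_neg h1, zero_mul])

theorem projL_apply_of_equi (f : IncidenceAlgebra R X) {a b : X} (h : Equi a b) :
    (projL T R X f : IncidenceAlgebra R X) a b = f a b := if_pos h

theorem projL_coe (a : L T R X) : projL T R X a = a := by
  ext x y _
  by_cases h : Equi x y
  · exact projL_apply_of_equi T R X _ h
  · exact (if_neg h).trans (a.2 x y h).symm

theorem projL_eq_zero {f : IncidenceAlgebra R X} (hf : f ∈ M T R X) : projL T R X f = 0 := by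
  ext x y _
  by_cases h : Equi x y
  · exact (projL_apply_of_equi T R X _ h).trans (hf x y h)
  · exact if_neg h

theorem sub_projL_mem (f : IncidenceAlgebra R X) :
    f - (projL T R X f : IncidenceAlgebra R X) ∈ M T R X := by
  intro x y h
  rw [IncidenceAlgebra.sub_apply, projL_apply_of_equi T R X f h, sub_self]

theorem projL_triangular {φ : AutK T R X} (hφ : φ ∈ Tri T R X) (f : IncidenceAlgebra R X) :
    projL T R X (φ (projL T R X f : IncidenceAlgebra R X)) = projL T R X (φ f) := by
  have h := projL_eq_zero T R X (autPreserving_mem hφ (sub_projL_mem T R X f))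
  rw [map_sub, map_sub, sub_eq_zero] at h
  exact h.symm

/-- `f : φ = (α 0; δ β) ↦ α`, where `α(a)` is the `L`-component of `φ(a)` for `a ∈ L`. -/
def fHom : Tri T R X →* (L T R X ≃ₐ[T] L T R X) where
  toFun φ :=
    AlgEquiv.ofAlgHom
      ((projL T R X).comp ((φ.1 : IncidenceAlgebra R X →ₐ[T] IncidenceAlgebra R X).comp
        (L T R X).val))
      ((projL T R X).comp (((φ⁻¹).1 : IncidenceAlgebra R X →ₐ[T] IncidenceAlgebra R X).comp
        (L T R X).val))
      (by
        ext1 a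
        change projL T R X (φ.1 (projL T R X (φ.1.symm a) : IncidenceAlgebra R X)) = a
        rw [projL_triangular T R X φ.2, AlgEquiv.apply_symm_apply, projL_coe])
      (by
        ext1 a
        change projL T R X ((φ⁻¹).1 (projL T R X (φ.1 a) : IncidenceAlgebra R X)) = a
        rw [projL_triangular T R X (φ⁻¹).2]
        exact (congrArg _ (φ.1.symm_apply_apply _)).trans (projL_coe T R X a))
  map_one' := by
    ext1 a
    exact projL_coe T R X a
  map_mul' φ ψ := by
    ext1 a
    exact (projL_triangular T R X φ.2 _).symm

theorem fHom_apply (φ : Tri T R X) (a : L T R X) :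
    fHom T R X φ a = projL T R X (φ.1 a) := rfl

/-- `Ω`, the image of `f`. -/
def Om : Subgroup (L T R X ≃ₐ[T] L T R X) := (fHom T R X).range

/-- `Ω_1 = {α ∈ Ω | α R_x = R_x for all x}`. -/
def Om1 : Subgroup (L T R X ≃ₐ[T] L T R X) :=
  Om T R X ⊓ ⨅ x : X, autPreserving T {a : L T R X | (a : IncidenceAlgebra R X) ∈ Rx T R x}

/-- `Ω_1 / In(Aut L)`. -/
abbrev Om1Quot : Type _ := Om1 T R X ⧸ (Inn T (L T R X)).subgroupOf (Om1 T R X)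

theorem Rx_le_L {x : X} {f : IncidenceAlgebra R X} (hf : f ∈ Rx T R x) : f ∈ L T R X := by
  intro z y h
  refine hf z y ?_
  by_contra! h'
  exact h (AntisymmRel.trans h'.1 h'.2.symm)

theorem C_le_Tri : C T R X ≤ Tri T R X := fun _ h => h.1.2

/-- The restriction `C → Ω_1` of `f`. -/
def fC : C T R X →* Om1 T R X :=
  ((fHom T R X).comp (Subgroup.inclusion (C_le_Tri T R X))).codRestrict (Om1 T R X) (by
    rintro ⟨φ, hφ⟩
    refine ⟨⟨_, rfl⟩, ?_⟩
    refine Subgroup.mem_iInf.2 fun x => ?_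
    have hx : φ '' (Rx T R x : Set (IncidenceAlgebra R X)) = Rx T R x :=
      Subgroup.mem_iInf.1 hφ.2 x
    have key : ∀ a : L T R X, (a : IncidenceAlgebra R X) ∈ Rx T R x →
        ((fHom T R X ⟨φ, hφ.1.2⟩ a : L T R X) : IncidenceAlgebra R X) = φ a := by
      intro a ha
      have hL : φ a ∈ L T R X := autPreserving_mem hφ.1.1 a.2
      exact congrArg Subtype.val (projL_coe T R X ⟨φ a, hL⟩)
    rw [mem_autPreserving]
    ext b
    constructor
    · rintro ⟨a, ha, rfl⟩
      change ((fHom T R X ⟨φ, hφ.1.2⟩ a : L T R X) : IncidenceAlgebra R X) ∈ Rx T R x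
      rw [key a ha]
      exact autPreserving_mem (Subgroup.mem_iInf.1 hφ.2 x) ha
    · intro hb
      have hb' : (b : IncidenceAlgebra R X) ∈ (Rx T R x : Set (IncidenceAlgebra R X)) := hb
      rw [← hx] at hb'
      obtain ⟨a, ha, hab⟩ := hb'
      exact ⟨⟨a, Rx_le_L T R X ha⟩, ha, Subtype.ext ((key _ ha).trans hab)⟩)

/-! ### Ordinal automorphisms -/

/-- The embedding `t : Aut X → Aut K`. With the inverse in the formula, `τ` acts by
`f ↦ ((x, y) ↦ f(τ⁻¹ x, τ⁻¹ y))`, which makes `t` a homomorphism for the composition of maps;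
its image is the same as without the inverse. -/
def ordinal : (X ≃o X) →* AutK T R X where
  toFun τ :=
    let g (σ : X ≃o X) : IncidenceAlgebra R X →ₐ[T] IncidenceAlgebra R X :=
      AlgHom.ofLinearMap
        { toFun := fun f => ⟨fun x y => f (σ x) (σ y), fun _ _ h =>
            IncidenceAlgebra.apply_eq_zero_of_not_le (fun h' => h (σ.le_iff_le.1 h')) f⟩
          map_add' := fun _ _ => rfl
          map_smul' := fun _ _ => rfl }
        (by
          ext x y _
          change (if σ x = σ y then (1 : R) else 0) = if x = y then 1 else 0
          simp)
        (by
          intro f h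
          ext x y _
          change ∑ z ∈ Finset.Icc (σ x) (σ y), f (σ x) z * h z (σ y) =
            ∑ z ∈ Finset.Icc x y, f (σ x) (σ z) * h (σ z) (σ y)
          refine (Finset.sum_equiv σ.toEquiv (fun z => ?_) fun _ _ => rfl).symm
          simp)
    AlgEquiv.ofAlgHom (g τ⁻¹) (g τ)
      (by
        ext f x y _
        change f (τ (τ.symm x)) (τ (τ.symm y)) = f x y
        simp)
      (by
        ext f x y _
        change f (τ.symm (τ x)) (τ.symm (τ y)) = f x y
        simp)
  map_one' := rfl
  map_mul' _ _ := rfl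

theorem ordinal_apply (τ : X ≃o X) (f : IncidenceAlgebra R X) (x y : X) :
    ordinal T R X τ f x y = f (τ⁻¹ x) (τ⁻¹ y) := rfl

theorem ordinal_mem_Tri (τ : X ≃o X) : ordinal T R X τ ∈ Tri T R X := by
  have h : ∀ σ : X ≃o X, ∀ f ∈ M T R X, ordinal T R X σ f ∈ M T R X := by
    intro σ f hf x y hxy
    exact hf _ _ ⟨(σ⁻¹).monotone hxy.1, (σ⁻¹).monotone hxy.2⟩
  change _ '' _ = _
  ext f
  constructor
  · rintro ⟨g, hg, rfl⟩
    exact h τ g hg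
  · intro hf
    refine ⟨ordinal T R X τ⁻¹ f, h τ⁻¹ f hf, ?_⟩
    change (ordinal T R X τ * ordinal T R X τ⁻¹) f = f
    rw [← map_mul, mul_inv_cancel, map_one, AlgEquiv.one_apply]

variable {X}

/-- The map `Out X → Aut X → Aut K` attached to an embedding `s` of `Out X` in `Aut X`. -/
def outToAutK (s : OutOrd X →* (X ≃o X)) : OutOrd X →* AutK T R X := (ordinal T R X).comp s

/-- The map `Out X → Aut X → Aut K → Aut L`. -/
def outToAutL (s : OutOrd X →* (X ≃o X)) : OutOrd X →* (L T R X ≃ₐ[T] L T R X) :=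
  (fHom T R X).comp
    (((ordinal T R X).codRestrict (Tri T R X) (ordinal_mem_Tri T R X)).comp s)

end Defs

end IncAut

end

open IncAut

open scoped Pointwise

noncomputable section

set_option linter.unusedSectionVars false

namespace IncAut

/-! Everything is read off from the idempotents `e_x`: the corners `e_x K e_y` determine `L`, `M`,
`R_x` and the preorder itself, since `e_x K e_y ≠ 0` exactly when `x ≤ y`. Hence an automorphism
permuting the `e_x` is diagonal, and `C` is the pointwise stabilizer of the `e_x` (`mem_C_iff`).

Condition (II) says that `φ` permutes the `e_x` only modulo `M`. As `1 + M` consists of units,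
idempotents congruent modulo `M` to some `e_x` are conjugate to it. This yields `φ M = M` for every
`φ` (`map_mem_M`) and, by straightening all `φ(e_x)` with a single unit of `1 + M`, the
factorization `Aut K = In_1 Λ` (`exists_In1_mul_Lam`). The factors meet trivially because `L ∩ M =
0`.

An element of `Λ` permutes the `e_x`, so it induces an order automorphism of the set of classes.
Condition (1) or (2) makes it preserve class sizes, so it lifts to `X`
(`exists_orderIso_of_mem_Lam`); dividing by the lift leaves an element of `C`. Thus `Λ = C ⋊ Out X`.
The homomorphism `f` kills `In_1`, maps `Λ` onto `Ω` and `C` onto `Ω_1` with kernel `Ψ` on `C`,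
which transfers the decomposition to `Ω`.

For `Out K`: `Inn = In_1 In_0` with `In_0 ≤ C`, and `Inn ∩ C = In_0`, `Inn ∩ Ψ = Ψ_0`. All three
isomorphisms are then instances of `IsInternalSemidirect.exists_quotient_mulEquiv`, which computes
`G / B` from `G = (B C) ⋊ Q`. -/

theorem equi_iff_mem {X : Type*} [Preorder X] [LocallyFiniteOrder X] {a x : X} :
    Equi a x ↔ a ∈ Finset.Icc x x := by
  rw [Finset.mem_Icc]
  exact ⟨fun h => ⟨h.2, h.1⟩, fun h => ⟨h.2, h.1⟩⟩

/-! ### The idempotents `e_x`, and `L`, `M`, `R_x` in terms of them -/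

section Blocks

variable {T R X : Type*} [CommRing T] [Ring R] [Algebra T R]
  [Preorder X] [LocallyFiniteOrder X] [DecidableEq X]

theorem e_apply (x a b : X) :
    e R x a b = if a = b ∧ a ∈ Finset.Icc x x then (1 : R) else 0 := rfl

theorem e_mul_apply (x : X) (f : IncidenceAlgebra R X) (a b : X) :
    (e R x * f) a b = if a ∈ Finset.Icc x x then f a b else 0 := by
  rw [IncidenceAlgebra.mul_apply]
  by_cases hab : a ≤ b
  · rw [Finset.sum_eq_single_of_mem a (Finset.left_mem_Icc.2 hab)
      (fun z _ hz => by rw [e_apply, if_neg (fun h => hz h.1.symm), zero_mul]), e_apply]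
    by_cases h : a ∈ Finset.Icc x x <;> simp [h]
  · rw [Finset.Icc_eq_empty hab, Finset.sum_empty,
      IncidenceAlgebra.apply_eq_zero_of_not_le hab, ite_self]

theorem mul_e_apply (y : X) (f : IncidenceAlgebra R X) (a b : X) :
    (f * e R y) a b = if b ∈ Finset.Icc y y then f a b else 0 := by
  rw [IncidenceAlgebra.mul_apply]
  by_cases hab : a ≤ b
  · rw [Finset.sum_eq_single_of_mem b (Finset.right_mem_Icc.2 hab)
      (fun z _ hz => by rw [e_apply, if_neg (fun h => hz h.1), mul_zero]), e_apply]
    by_cases h : b ∈ Finset.Icc y y <;> simp [h]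
  · rw [Finset.Icc_eq_empty hab, Finset.sum_empty,
      IncidenceAlgebra.apply_eq_zero_of_not_le hab, ite_self]

theorem e_mul_mul_e_apply (x y : X) (f : IncidenceAlgebra R X) (a b : X) :
    (e R x * f * e R y) a b =
      if a ∈ Finset.Icc x x ∧ b ∈ Finset.Icc y y then f a b else 0 := by
  rw [mul_e_apply, e_mul_apply]
  by_cases h1 : a ∈ Finset.Icc x x <;> by_cases h2 : b ∈ Finset.Icc y y <;> simp [h1, h2]

theorem e_congr {x y : X} (h : Equi x y) : e R x = e R y := by
  ext a b _
  have : a ∈ Finset.Icc x x ↔ a ∈ Finset.Icc y y := by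
    rw [← equi_iff_mem, ← equi_iff_mem]
    exact ⟨fun h' => h'.trans h, fun h' => h'.trans h.symm⟩
  simp only [e_apply, this]

theorem e_mul_self (x : X) : e R x * e R x = e R x := by
  ext a b _
  rw [e_mul_apply, e_apply]
  by_cases h : a ∈ Finset.Icc x x <;> simp [h]

theorem e_mul_e {x y : X} (h : ¬ Equi x y) : e R x * e R y = 0 := by
  ext a b _
  rw [e_mul_apply, e_apply, IncidenceAlgebra.zero_apply]
  split_ifs with h1 h2
  · exact absurd ((equi_iff_mem.2 h1).symm.trans (equi_iff_mem.2 h2.2)) h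
  · rfl
  · rfl

theorem e_self (x : X) : e R x x x = 1 := by
  rw [e_apply, if_pos ⟨rfl, equi_iff_mem.1 AntisymmRel.rfl⟩]

theorem equi_of_sub_mem_M [Nontrivial R] {x y : X} (h : e R x - e R y ∈ M T R X) : Equi x y := by
  by_contra hn
  have := h x x AntisymmRel.rfl
  rw [IncidenceAlgebra.sub_apply, e_self, e_apply, if_neg, sub_zero] at this
  · exact one_ne_zero this
  · exact fun h' => hn (equi_iff_mem.2 h'.2)

theorem equi_of_e_eq [Nontrivial R] {x y : X} (h : e R x = e R y) : Equi x y :=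
  -- The statement involves no base ring, so any one serves to form `M`; `ℤ` always acts on `R`.
  equi_of_sub_mem_M (T := ℤ) (by rw [h, sub_self]; exact zero_mem _)

theorem e_mem_Rx (x : X) : e R x ∈ Rx T R x := by
  intro z y h
  rw [e_apply, if_neg]
  rintro ⟨rfl, h'⟩
  have := equi_iff_mem.2 h'
  tauto

theorem e_mem_L (x : X) : e R x ∈ L T R X := Rx_le_L T R X (e_mem_Rx x)

theorem mem_Rx_iff {x : X} {f : IncidenceAlgebra R X} :
    f ∈ Rx T R x ↔ e R x * f * e R x = f := by
  constructor
  · intro hf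
    ext a b _
    rw [e_mul_mul_e_apply]
    split_ifs with h
    · rfl
    · rw [hf a b]
      rw [equi_iff_mem, equi_iff_mem]
      tauto
  · intro hf z y h
    rw [← hf, e_mul_mul_e_apply, if_neg]
    rw [equi_iff_mem, equi_iff_mem] at h
    tauto

theorem mem_L_iff {f : IncidenceAlgebra R X} :
    f ∈ L T R X ↔ ∀ x y, ¬ Equi x y → e R x * f * e R y = 0 := by
  constructor
  · intro hf x y hxy
    ext a b _
    rw [e_mul_mul_e_apply]
    split_ifs with h
    · refine hf a b fun hab => hxy ?_
      exact ((equi_iff_mem.2 h.1).symm.trans hab).trans (equi_iff_mem.2 h.2)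
    · rfl
  · intro hf x y hxy
    have := congrArg (fun g : IncidenceAlgebra R X => g x y) (hf x y hxy)
    simpa only [e_mul_mul_e_apply, ← equi_iff_mem, AntisymmRel.rfl, and_self, if_true,
      IncidenceAlgebra.zero_apply] using this

theorem mem_M_iff {f : IncidenceAlgebra R X} :
    f ∈ M T R X ↔ ∀ x, e R x * f * e R x = 0 := by
  constructor
  · intro hf x
    ext a b _
    rw [e_mul_mul_e_apply]
    split_ifs with h
    · exact hf a b ((equi_iff_mem.2 h.1).trans (equi_iff_mem.2 h.2).symm)
    · rfl
  · intro hf x y hxy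
    have := congrArg (fun g : IncidenceAlgebra R X => g x y) (hf x)
    simpa only [e_mul_mul_e_apply, ← equi_iff_mem, AntisymmRel.rfl, hxy.symm, and_self,
      if_true, IncidenceAlgebra.zero_apply] using this

theorem e_mul_comm {a : IncidenceAlgebra R X} (ha : a ∈ L T R X) (x : X) :
    e R x * a = a * e R x := by
  ext y z _
  rw [e_mul_apply, mul_e_apply]
  by_cases h : Equi y z
  · have : y ∈ Finset.Icc x x ↔ z ∈ Finset.Icc x x := by
      rw [← equi_iff_mem, ← equi_iff_mem]
      exact ⟨fun h' => h.symm.trans h', fun h' => h.trans h'⟩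
    simp only [this]
  · rw [ha y z h, ite_self, ite_self]

theorem mem_L_of_comm {a : IncidenceAlgebra R X} (ha : ∀ x, e R x * a = a * e R x) :
    a ∈ L T R X := by
  refine mem_L_iff.2 fun x y h => ?_
  rw [ha, mul_assoc, e_mul_e h, mul_zero]

theorem eq_zero_of_mem_L_of_mem_M {f : IncidenceAlgebra R X} (hL : f ∈ L T R X)
    (hM : f ∈ M T R X) : f = 0 := by
  ext a b _
  by_cases h : Equi a b
  · exact hM a b h
  · exact hL a b h

theorem projL_eq_zero_iff {f : IncidenceAlgebra R X} : projL T R X f = 0 ↔ f ∈ M T R X := by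
  refine ⟨fun h => ?_, projL_eq_zero T R X⟩
  have := sub_projL_mem T R X f
  rwa [h, ZeroMemClass.coe_zero, sub_zero] at this

theorem projL_eq_iff {f g : IncidenceAlgebra R X} :
    projL T R X f = projL T R X g ↔ f - g ∈ M T R X := by
  rw [← projL_eq_zero_iff, map_sub, sub_eq_zero]

/-- This recovers the preorder from the idempotents by an algebraic condition, which automorphisms
preserve. The witness is the zeta function, whose entry at `(x, y)` is `1`. -/
theorem exists_e_mul_mul_e_ne_zero_iff [Nontrivial R] {x y : X} :
    (∃ f : IncidenceAlgebra R X, e R x * f * e R y ≠ 0) ↔ x ≤ y := by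
  constructor
  · rintro ⟨f, hf⟩
    by_contra h
    refine hf ?_
    ext a b _
    rw [e_mul_mul_e_apply]
    split_ifs with h'
    · refine IncidenceAlgebra.apply_eq_zero_of_not_le (fun hab => h ?_) f
      exact ((equi_iff_mem.2 h'.1).2.trans hab).trans (equi_iff_mem.2 h'.2).1
    · rfl
  · intro h
    classical
    refine ⟨IncidenceAlgebra.zeta R, fun h0 => ?_⟩
    have := congrArg (fun g : IncidenceAlgebra R X => g x y) h0
    simp only [e_mul_mul_e_apply, ← equi_iff_mem, AntisymmRel.rfl, and_self, if_true] at this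
    rw [IncidenceAlgebra.zeta_of_le h] at this
    exact one_ne_zero this

/-! ### Invertibility of `1 + d` for `d ∈ M` -/

/-- A nonzero factor `d x z` forces `z ≁ x`, so `[z, y]` omits `x` and is strictly smaller than `[x,
y]`. For `n = 0` the interval is empty and the entry vanishes by definition. -/
theorem pow_apply_eq_zero {d : IncidenceAlgebra R X} (hd : d ∈ M T R X) (n : ℕ) :
    ∀ x y : X, (Finset.Icc x y).card ≤ n → (d ^ n) x y = 0 := by
  induction n with
  | zero =>
    intro x y h
    refine IncidenceAlgebra.apply_eq_zero_of_not_le (fun hxy => ?_) _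
    have := Finset.card_pos.2 ⟨x, Finset.left_mem_Icc.2 hxy⟩
    omega
  | succ n ih =>
    intro x y h
    rw [pow_succ', IncidenceAlgebra.mul_apply]
    refine Finset.sum_eq_zero fun z hz => ?_
    have hz := Finset.mem_Icc.1 hz
    by_cases hxz : Equi x z
    · rw [hd x z hxz, zero_mul]
    · rw [ih z y, mul_zero]
      have : Finset.Icc z y ⊂ Finset.Icc x y := by
        refine (Finset.ssubset_iff_of_subset (Finset.Icc_subset_Icc_left hz.1)).2
          ⟨x, Finset.left_mem_Icc.2 (hz.1.trans hz.2), fun h' => hxz ⟨hz.1, ?_⟩⟩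
        exact (Finset.mem_Icc.1 h').1
      have := Finset.card_lt_card this
      omega

/-- The locally finite geometric series of `d`. -/
def geomSeries (d : IncidenceAlgebra R X) : IncidenceAlgebra R X where
  toFun x y := (∑ n ∈ Finset.range (Finset.Icc x y).card, d ^ n) x y
  eq_zero_of_not_le' _ _ h := IncidenceAlgebra.apply_eq_zero_of_not_le h _

theorem finset_sum_apply (s : Finset ℕ) (f : ℕ → IncidenceAlgebra R X) (x y : X) :
    (∑ n ∈ s, f n) x y = ∑ n ∈ s, f n x y := by
  classical
  induction s using Finset.induction_on with
  | empty => rfl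
  | insert a s ha ih => rw [Finset.sum_insert ha, Finset.sum_insert ha, ← ih]; rfl

/-- Any bound on the interval size may serve as truncation, so all entries in a convolution over
`[x, y]` can share the length `|[x, y]|`, and the finite geometric sum formula applies. -/
theorem geomSeries_apply {d : IncidenceAlgebra R X} (hd : d ∈ M T R X) {x y : X} {N : ℕ}
    (hN : (Finset.Icc x y).card ≤ N) :
    geomSeries d x y = (∑ n ∈ Finset.range N, d ^ n) x y := by
  change (∑ n ∈ Finset.range (Finset.Icc x y).card, d ^ n) x y = _
  rw [finset_sum_apply, finset_sum_apply]
  refine Finset.sum_subset (Finset.range_subset_range.2 hN) fun n _ hn => ?_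
  exact pow_apply_eq_zero hd n x y (by simpa using hn)

theorem isUnit_of_sub_one_mem {u : IncidenceAlgebra R X} (hu : u - 1 ∈ M T R X) : IsUnit u := by
  obtain ⟨d, rfl⟩ : ∃ d, u = 1 - d := ⟨1 - u, by abel⟩
  have hd : d ∈ M T R X := by
    have := neg_mem hu
    rwa [sub_sub_cancel_left, neg_neg] at this
  refine isUnit_iff_exists.2 ⟨geomSeries d, ?_, ?_⟩
  · ext x y _
    have h1 : ((1 - d) * geomSeries d) x y =
        ((1 - d) * ∑ n ∈ Finset.range (Finset.Icc x y).card, d ^ n) x y := by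
      rw [IncidenceAlgebra.mul_apply, IncidenceAlgebra.mul_apply]
      refine Finset.sum_congr rfl fun z hz => ?_
      rw [geomSeries_apply hd
        (Finset.card_le_card (Finset.Icc_subset_Icc_left (Finset.mem_Icc.1 hz).1))]
    rw [h1, mul_neg_geom_sum, IncidenceAlgebra.sub_apply, pow_apply_eq_zero hd _ _ _ le_rfl,
      sub_zero]
  · ext x y _
    have h1 : (geomSeries d * (1 - d)) x y =
        ((∑ n ∈ Finset.range (Finset.Icc x y).card, d ^ n) * (1 - d)) x y := by
      rw [IncidenceAlgebra.mul_apply, IncidenceAlgebra.mul_apply]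
      refine Finset.sum_congr rfl fun z hz => ?_
      rw [geomSeries_apply hd
        (Finset.card_le_card (Finset.Icc_subset_Icc_right (Finset.mem_Icc.1 hz).2))]
    rw [h1, geom_sum_mul_neg, IncidenceAlgebra.sub_apply, pow_apply_eq_zero hd _ _ _ le_rfl,
      sub_zero]

/-! ### The action of `Aut K` on the idempotents `e_x` -/

theorem mem_autPreserving_of {A : Type*} [Ring A] [Algebra T A] {S : Set A} {φ : A ≃ₐ[T] A}
    (h1 : ∀ a ∈ S, φ a ∈ S) (h2 : ∀ a ∈ S, φ⁻¹ a ∈ S) : φ ∈ autPreserving T S := by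
  rw [mem_autPreserving]
  ext a
  constructor
  · rintro ⟨b, hb, rfl⟩
    exact h1 b hb
  · exact fun ha => ⟨_, h2 a ha, φ.apply_symm_apply a⟩

theorem apply_inv_apply {A : Type*} [Ring A] [Algebra T A] (φ : A ≃ₐ[T] A) (a : A) :
    φ (φ⁻¹ a) = a := φ.apply_symm_apply a

theorem inv_apply_apply {A : Type*} [Ring A] [Algebra T A] (φ : A ≃ₐ[T] A) (a : A) :
    φ⁻¹ (φ a) = a := φ.symm_apply_apply a

theorem mul_sub_mul_mem_M {p q f g : IncidenceAlgebra R X} (h1 : p - q ∈ M T R X)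
    (h2 : f - g ∈ M T R X) : p * f - q * g ∈ M T R X := by
  rw [← projL_eq_iff] at *
  rw [map_mul, map_mul, h1, h2]

section ModM

variable [Nontrivial R]

/-- If `x ≁ x'`, then `e_x e_x' = 0`, while its image is congruent to `e_y e_y' = e_y'`, which is
not in `M`. -/
theorem equi_of_map_e {φ : AutK T R X} {x x' y y' : X} (h : φ (e R x) - e R y ∈ M T R X)
    (h' : φ (e R x') - e R y' ∈ M T R X) (hy : Equi y y') : Equi x x' := by
  by_contra hn
  have := mul_sub_mul_mem_M h h'
  rw [← map_mul, e_mul_e hn, map_zero, e_congr hy, e_mul_self] at this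
  have := this y' y' AntisymmRel.rfl
  rw [IncidenceAlgebra.sub_apply, e_self, IncidenceAlgebra.zero_apply, zero_sub] at this
  exact one_ne_zero (neg_eq_zero.1 this)

/-- An idempotent congruent to `e_x` modulo `M` is conjugate to `e_x`. -/
theorem exists_unit_of_idempotent {p : IncidenceAlgebra R X} (hp : p * p = p) {x : X}
    (h : p - e R x ∈ M T R X) : ∃ u : IncidenceAlgebra R X, IsUnit u ∧ p * u = u * e R x := by
  have hx := e_mul_self (R := R) x
  -- Modulo `M` this element is `e_x + (1 - e_x) = 1`, and multiplying by `p` on the left or by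
  -- `e_x` on the right gives `p e_x` in both cases.
  refine ⟨p * e R x + (1 - p) * (1 - e R x), isUnit_of_sub_one_mem (T := T) ?_, ?_⟩
  · rw [← projL_eq_iff] at *
    rw [map_add, map_mul, map_mul, map_sub, map_sub, map_one, h, ← map_one (projL T R X),
      ← map_sub, ← map_mul, ← map_mul, ← map_add]
    congr 1
    rw [hx, mul_sub, mul_one, sub_mul, hx, one_mul, sub_self, sub_zero, add_sub_cancel]
  · have e1 : p * (1 - p) = 0 := by rw [mul_sub, hp, mul_one, sub_self]
    have e2 : (1 - e R x) * e R x = 0 := by rw [sub_mul, hx, one_mul, sub_self]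
    rw [mul_add, add_mul, ← mul_assoc, ← mul_assoc, hp, e1, zero_mul, mul_assoc, mul_assoc, hx,
      e2, mul_zero]

/-- Condition (II) for `φ⁻¹` gives `φ⁻¹(e_y) ≡ e_x`, but `φ` cannot be applied to this congruence
before `φ M ⊆ M` is known. Conjugacy replaces it by an equation `φ⁻¹(e_y) u = u e_x`, which `φ` does
respect. -/
theorem exists_map_e_sub_mem (hII : ConditionII T R X) (φ : AutK T R X) (y : X) :
    ∃ x, φ (e R x) - e R y ∈ M T R X := by
  obtain ⟨x, hx⟩ := hII φ⁻¹ y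
  obtain ⟨z, hz⟩ := hII φ x
  refine ⟨x, ?_⟩
  obtain ⟨u, hu, hux⟩ := exists_unit_of_idempotent (p := φ⁻¹ (e R y))
    (by rw [← map_mul, e_mul_self]) hx
  have h1 := congrArg (fun a => projL T R X (φ a)) hux
  simp only [map_mul, apply_inv_apply] at h1
  rw [← projL_eq_iff] at hz ⊢
  rw [hz] at h1 ⊢
  -- Every `e_z` is central in `L`, so the projected equation reads `e_y v = e_z v` with `v` the
  -- invertible `L`-component of `φ(u)`, and `v` cancels.
  have hc : projL T R X (φ u) * projL T R X (e R z) =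
      projL T R X (e R z) * projL T R X (φ u) := by
    rw [show projL T R X (e R z) = ⟨e R z, e_mem_L z⟩ from projL_coe T R X ⟨e R z, e_mem_L z⟩]
    exact Subtype.ext (e_mul_comm (projL T R X (φ u)).2 z).symm
  rw [hc] at h1
  have hu' : IsUnit (projL T R X (φ u)) := (hu.map φ).map (projL T R X)
  exact (hu'.mul_right_cancel h1).symm

/-- Each `e_y` is congruent to some `φ(e_x)`, so `e_y φ(f) e_y ≡ φ(e_x f e_x) = 0` modulo `M`. -/
theorem map_mem_M (hII : ConditionII T R X) (φ : AutK T R X) {f : IncidenceAlgebra R X}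
    (hf : f ∈ M T R X) : φ f ∈ M T R X := by
  rw [mem_M_iff]
  intro y
  obtain ⟨x, hx⟩ := exists_map_e_sub_mem hII φ y
  have h0 : e R y * φ f * e R y ∈ M T R X := by
    rw [← projL_eq_iff] at hx
    rw [← projL_eq_zero_iff, map_mul, map_mul, ← hx, ← map_mul, ← map_mul, ← map_mul, ← map_mul,
      mem_M_iff.1 hf x, map_zero, map_zero]
  have := mem_M_iff.1 h0 y
  have hy := e_mul_self (R := R) y
  rwa [← mul_assoc, ← mul_assoc, hy, mul_assoc, hy] at this

theorem mem_Tri (hII : ConditionII T R X) (φ : AutK T R X) : φ ∈ Tri T R X :=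
  mem_autPreserving_of (fun _ h => map_mem_M hII φ h) (fun _ h => map_mem_M hII φ⁻¹ h)

theorem mem_Lam_of {φ : AutK T R X} (h : ∀ x, ∃ y, φ (e R x) = e R y)
    (h' : ∀ y, ∃ x, φ (e R x) = e R y) : φ ∈ Lam T R X := by
  have key : ∀ φ : AutK T R X, (∀ y, ∃ x, φ (e R x) = e R y) →
      (∀ f ∈ L T R X, φ f ∈ L T R X) ∧ (∀ f ∈ M T R X, φ f ∈ M T R X) := by
    intro φ h'
    refine ⟨fun f hf => mem_L_iff.2 fun y y' hy => ?_, fun f hf => mem_M_iff.2 fun y => ?_⟩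
    · obtain ⟨x, hx⟩ := h' y
      obtain ⟨x', hx'⟩ := h' y'
      rw [← hx, ← hx', ← map_mul, ← map_mul, mem_L_iff.1 hf x x', map_zero]
      exact fun hxx => hy (equi_of_e_eq (R := R) (by rw [← hx, ← hx', e_congr hxx]))
    · obtain ⟨x, hx⟩ := h' y
      rw [← hx, ← map_mul, ← map_mul, mem_M_iff.1 hf x, map_zero]
  have k1 := key φ h'
  have k2 := key φ⁻¹ fun y => by
    obtain ⟨x, hx⟩ := h y
    exact ⟨x, by rw [← hx, inv_apply_apply]⟩
  exact ⟨mem_autPreserving_of k1.1 k2.1, mem_autPreserving_of k1.2 k2.2⟩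

theorem exists_map_e_of_mem_Lam (hII : ConditionII T R X) {φ : AutK T R X} (h : φ ∈ Lam T R X)
    (x : X) : ∃ y, φ (e R x) = e R y := by
  obtain ⟨y, hy⟩ := hII φ x
  refine ⟨y, sub_eq_zero.1 (eq_zero_of_mem_L_of_mem_M (T := T) ?_ hy)⟩
  exact sub_mem (autPreserving_mem h.1 (e_mem_L x)) (e_mem_L y)

theorem exists_In1_mul_Lam (hII : ConditionII T R X) (φ : AutK T R X) :
    ∃ i ∈ In1 T R X, ∃ ψ ∈ Lam T R X, i * ψ = φ := by
  choose ρ hρ using exists_map_e_sub_mem hII φ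
  have hρe : ∀ b y, Equi b y → e R (ρ b) = e R (ρ y) := fun b y h =>
    e_congr (equi_of_map_e (hρ b) (hρ y) h)
  -- This is the sum over all classes of `φ(e_{ρ y}) e_y`, defined column by column so that it makes
  -- sense for infinitely many classes.
  let u : IncidenceAlgebra R X :=
    ⟨fun a b => φ (e R (ρ b)) a b, fun _ _ h => IncidenceAlgebra.apply_eq_zero_of_not_le h _⟩
  have hu1 : u - 1 ∈ M T R X := by
    intro a b hab
    have := hρ b a b hab
    rw [IncidenceAlgebra.sub_apply, e_apply] at this
    rw [IncidenceAlgebra.sub_apply, IncidenceAlgebra.one_apply]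
    change φ (e R (ρ b)) a b - _ = 0
    simpa only [equi_iff_mem.1 hab, and_true, IncidenceAlgebra.zero_apply] using this
  have hue : ∀ y, u * e R y = φ (e R (ρ y)) * e R y := by
    intro y
    ext a b _
    rw [mul_e_apply, mul_e_apply]
    split_ifs with h
    · change φ (e R (ρ b)) a b = _
      rw [hρe b y (equi_iff_mem.2 h)]
    · rfl
  have hcomm : ∀ y, φ (e R (ρ y)) * u = u * e R y := by
    intro y
    -- Right multiplication by `e_b` isolates the columns in `[b]`; there the claim is the
    -- orthogonality of the idempotents `φ(e_{ρ y})`.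
    have : ∀ b, φ (e R (ρ y)) * u * e R b = u * e R y * e R b := by
      intro b
      rw [mul_assoc, hue, ← mul_assoc, ← map_mul, mul_assoc]
      by_cases h : Equi y b
      · rw [← e_congr h, hρe b y h.symm, e_mul_self, e_mul_self, hue]
      · rw [e_mul_e h, e_mul_e, map_zero, mul_zero, zero_mul]
        refine fun h' => h (equi_of_sub_mem_M (T := T) (R := R) ?_)
        have h1 := hρ y
        rw [e_congr h'] at h1
        have := sub_mem (hρ b) h1
        rwa [sub_sub_sub_cancel_left] at this
    ext a b _
    have := congrArg (fun g : IncidenceAlgebra R X => g a b) (this b)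
    simpa only [mul_e_apply _ (_ * _), ← equi_iff_mem (a := b) (x := b), AntisymmRel.rfl,
      if_true] using this
  obtain ⟨v, hv⟩ := isUnit_of_sub_one_mem hu1
  have hvm : v ∈ unitsOne T R X := by
    change (v : IncidenceAlgebra R X) - 1 ∈ M T R X
    rw [hv]
    exact hu1
  have hψ : ∀ y, ((innerAut T v)⁻¹ * φ) (e R (ρ y)) = e R y := by
    intro y
    rw [← map_inv, AlgEquiv.mul_apply, innerAut_apply, inv_inv, hv, mul_assoc, hcomm, ← hv,
      Units.inv_mul_cancel_left]
  refine ⟨innerAut T v, Subgroup.mem_map_of_mem _ hvm, (innerAut T v)⁻¹ * φ,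
    mem_Lam_of (fun x => ?_) (fun y => ⟨_, hψ y⟩), mul_inv_cancel_left _ _⟩
  obtain ⟨y, hy⟩ := hII φ x
  refine ⟨y, ?_⟩
  rw [← hψ y, e_congr (equi_of_map_e hy (hρ y) AntisymmRel.rfl)]

end ModM

/-- Preserving `R_x` forces fixing its identity element `e_x`; conversely `R_x = e_x K e_x`. -/
theorem mem_C_iff [Nontrivial R] {φ : AutK T R X} : φ ∈ C T R X ↔ ∀ x, φ (e R x) = e R x := by
  constructor
  · intro h x
    have hx := Subgroup.mem_iInf.1 h.2 x
    have h1 : e R x ∈ φ '' (Rx T R x : Set (IncidenceAlgebra R X)) := by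
      rw [(mem_autPreserving T).1 hx]
      exact e_mem_Rx x
    obtain ⟨a, ha, hax⟩ := h1
    have h2 := mem_Rx_iff.1 (autPreserving_mem hx (e_mem_Rx (T := T) x))
    have h3 : a * e R x = a := by
      rw [← mem_Rx_iff.1 ha, mul_assoc, e_mul_self]
    have h4 : e R x * φ (e R x) = e R x := by
      have := congrArg φ h3
      rwa [map_mul, hax] at this
    rw [h4, e_mul_self] at h2
    exact h2.symm
  · intro h
    have h' : ∀ x, φ⁻¹ (e R x) = e R x := fun x => by
      conv_lhs => rw [← h x, inv_apply_apply]
    refine ⟨mem_Lam_of (fun x => ⟨x, h x⟩) (fun x => ⟨x, h x⟩), Subgroup.mem_iInf.2 fun x => ?_⟩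
    refine mem_autPreserving_of (fun a ha => mem_Rx_iff.2 ?_) (fun a ha => mem_Rx_iff.2 ?_)
    · conv_lhs => rw [← h x, ← map_mul, ← map_mul, mem_Rx_iff.1 ha]
    · conv_lhs => rw [← h' x, ← map_mul, ← map_mul, mem_Rx_iff.1 ha]

theorem ordinal_e (τ : X ≃o X) (x : X) : ordinal T R X τ (e R x) = e R (τ x) := by
  ext a b _
  have h : ∀ a, τ (τ⁻¹ a) = a := τ.apply_symm_apply
  have h1 : τ⁻¹ a ∈ Finset.Icc x x ↔ a ∈ Finset.Icc (τ x) (τ x) := by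
    rw [Finset.mem_Icc, Finset.mem_Icc, ← τ.le_iff_le, ← τ.le_iff_le (x := τ⁻¹ a), h]
  simp only [ordinal_apply, e_apply, h1, EmbeddingLike.apply_eq_iff_eq]

end Blocks

end IncAut

namespace IncAut

/-! ### Classes of the preorder and the splitting of `Aut X → Out X` -/

section OrderAut

variable {X : Type*} [Preorder X]

theorem mem_InnOrd_iff {τ : X ≃o X} : τ ∈ InnOrd X ↔ ∀ x, Equi (τ x) x := by
  constructor
  · intro h x
    have := h x (Set.left_mem_Icc.2 le_rfl)
    exact ⟨this.2, this.1⟩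
  · intro h x y hy
    exact ⟨hy.1.trans (h y).2, (h y).1.trans hy.2⟩

theorem mk_eq_mk_iff_equi {τ τ' : X ≃o X} :
    (QuotientGroup.mk τ : OutOrd X) = QuotientGroup.mk τ' ↔ ∀ x, Equi (τ x) (τ' x) := by
  rw [QuotientGroup.eq, mem_InnOrd_iff]
  have h : ∀ x, τ (τ⁻¹ x) = x := τ.apply_symm_apply
  constructor
  · intro h' x
    have h1 := h' x
    refine ⟨?_, ?_⟩
    · have := τ.monotone h1.2
      rwa [RelIso.mul_apply, h] at this
    · have := τ.monotone h1.1
      rwa [RelIso.mul_apply, h] at this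
  · intro h' x
    have h1 := h' x
    refine ⟨?_, ?_⟩
    · refine τ.le_iff_le.1 ?_
      rw [RelIso.mul_apply, h]
      exact h1.2
    · refine τ.le_iff_le.1 ?_
      rw [RelIso.mul_apply, h]
      exact h1.1

variable [LocallyFiniteOrder X]

theorem nx_congr {x y : X} (h : Equi x y) : nx x = nx y := by
  have : Finset.Icc x x = Finset.Icc y y := by
    ext z
    rw [← equi_iff_mem, ← equi_iff_mem]
    exact ⟨fun h' => h'.trans h, fun h' => h'.trans h.symm⟩
  rw [nx, nx, this]

theorem nx_pos (x : X) : 0 < nx x := Finset.card_pos.2 ⟨x, equi_iff_mem.1 AntisymmRel.rfl⟩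

theorem nx_map (τ : X ≃o X) (x : X) : nx (τ x) = nx x := by
  refine (Finset.card_equiv τ.toEquiv fun z => ?_).symm
  simp

/-- An enumeration of the class of `x`. -/
def blockEquiv (x : X) : Finset.Icc x x ≃ Fin (nx x) := (Finset.Icc x x).equivFin

variable (X) in
/-- A simultaneous enumeration of all classes `[x]`, where `elt x` and `pos` are mutually inverse
bijections between `{0, …, n_x - 1}` and `[x]`. -/
structure BlockEnumeration where
  /-- the index of an element in its class -/
  pos : X → ℕ
  /-- the element of the class of `x` with a given index -/
  elt : X → ℕ → X
  pos_lt : ∀ x, pos x < nx x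
  elt_equi : ∀ x i, Equi (elt x i) x
  pos_elt : ∀ x i, i < nx x → pos (elt x i) = i
  elt_pos : ∀ x, elt x (pos x) = x
  elt_congr : ∀ x y, Equi x y → ∀ i, elt x i = elt y i

variable (X) in
theorem nonempty_blockEnumeration : Nonempty (BlockEnumeration X) := by
  let r : X → X := fun x => Quotient.out (s := AntisymmRel.setoid X (· ≤ ·)) (Quotient.mk _ x)
  have hr : ∀ x, Equi (r x) x := fun x => Quotient.mk_out (s := AntisymmRel.setoid X (· ≤ ·)) x
  have hrr : ∀ x y, Equi x y → r x = r y := fun x y h =>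
    congrArg Quotient.out (Quotient.sound (s := AntisymmRel.setoid X (· ≤ ·)) h)
  have hmem : ∀ x, x ∈ Finset.Icc (r x) (r x) := fun x => equi_iff_mem.1 (hr x).symm
  classical
  let pos : X → X → ℕ := fun y x =>
    if h : x ∈ Finset.Icc y y then blockEquiv y ⟨x, h⟩ else 0
  -- The default `y` keeps the value inside the class, so `elt_equi` needs no bound on the index.
  let elt : X → ℕ → X := fun y i => if h : i < nx y then (blockEquiv y).symm ⟨i, h⟩ else y
  have helt : ∀ x i, Equi (elt (r x) i) x := by
    intro x i
    by_cases h : i < nx (r x)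
    · simp only [elt, dif_pos h]
      exact (equi_iff_mem.2 ((blockEquiv (r x)).symm ⟨i, h⟩).2).trans (hr x)
    · simp only [elt, dif_neg h]
      exact hr x
  refine ⟨⟨fun x => pos (r x) x, fun x i => elt (r x) i, fun x => ?_, helt,
    fun x i h => ?_, fun x => ?_, fun x y h i => by rw [hrr x y h]⟩⟩
  · rw [← nx_congr (hr x)]
    simp only [pos, dif_pos (hmem x)]
    exact Fin.is_lt _
  · rw [← nx_congr (hr x)] at h
    rw [hrr _ _ (helt x i)]
    simp [pos, elt, h, -Finset.mem_Icc]
  · simp [pos, elt, hmem, -Finset.mem_Icc]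

namespace BlockEnumeration

variable (B : BlockEnumeration X)

/-- Maps inverse to each other only up to `∼` become strictly inverse once `x` is sent to the
element of the class of `σ x` having the same index as `x`; equal class sizes make this index
available. -/
theorem exists_orderIso {σ σ' : X → X} (hσ : Monotone σ) (hσ' : Monotone σ')
    (h1 : ∀ x, Equi (σ (σ' x)) x) (h2 : ∀ x, Equi (σ' (σ x)) x) (hn : ∀ x, nx (σ x) = nx x) :
    ∃ τ : X ≃o X, ∀ x, τ x = B.elt (σ x) (B.pos x) := by
  have key : ∀ σ σ' : X → X, Monotone σ' → (∀ x, Equi (σ' (σ x)) x) → (∀ x, nx (σ x) = nx x) →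
      ∀ x, B.elt (σ' (B.elt (σ x) (B.pos x))) (B.pos (B.elt (σ x) (B.pos x))) = x := by
    intro σ σ' hσ' h2 hn x
    rw [B.pos_elt _ _ (by rw [hn]; exact B.pos_lt x)]
    conv_rhs => rw [← B.elt_pos x]
    have h := B.elt_equi (σ x) (B.pos x)
    exact B.elt_congr _ _ (AntisymmRel.trans ⟨hσ' h.1, hσ' h.2⟩ (h2 x)) _
  have hmono : ∀ σ : X → X, Monotone σ → Monotone fun x => B.elt (σ x) (B.pos x) :=
    fun σ hσ x y h => ((B.elt_equi _ _).1.trans (hσ h)).trans (B.elt_equi _ _).2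
  let ε : X ≃ X := ⟨fun x => B.elt (σ x) (B.pos x), fun x => B.elt (σ' x) (B.pos x),
    key σ σ' hσ' h2 hn, key σ' σ hσ h1 fun x => by rw [← hn, nx_congr (h1 x)]⟩
  exact ⟨ε.toOrderIso (hmono σ hσ) (hmono σ' hσ'), fun _ => rfl⟩

end BlockEnumeration

variable (X) in
-- Each `τ` is replaced by the index-preserving automorphism `F τ` with the same effect on classes.
-- It depends only on that effect, so `F` is multiplicative and trivial on `InnOrd X`.
theorem exists_outSection : ∃ s : OutOrd X →* (X ≃o X), IsOutSection s := by
  obtain ⟨B⟩ := nonempty_blockEnumeration X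
  have h : ∀ τ : X ≃o X, ∃ τ' : X ≃o X, ∀ x, τ' x = B.elt (τ x) (B.pos x) := fun τ =>
    B.exists_orderIso τ.monotone (τ⁻¹).monotone
      (fun x => by rw [show τ (τ⁻¹ x) = x from τ.apply_symm_apply x])
      (fun x => by rw [show τ⁻¹ (τ x) = x from τ.symm_apply_apply x])
      (nx_map τ)
  choose F hF using h
  have hmul : ∀ τ τ', F (τ * τ') = F τ * F τ' := by
    intro τ τ'
    ext x
    rw [RelIso.mul_apply, hF, hF, hF,
      B.pos_elt _ _ (by rw [nx_map]; exact B.pos_lt x)]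
    have h := B.elt_equi (τ' x) (B.pos x)
    exact (B.elt_congr _ _ ⟨τ.monotone h.1, τ.monotone h.2⟩ _).symm
  let Fh : (X ≃o X) →* (X ≃o X) := MonoidHom.mk' F hmul
  refine ⟨QuotientGroup.lift (InnOrd X) Fh fun τ hτ => ?_, fun q => ?_⟩
  · rw [mem_InnOrd_iff] at hτ
    ext x
    change F τ x = x
    rw [hF, B.elt_congr _ _ (hτ x), B.elt_pos]
  · obtain ⟨τ, rfl⟩ := QuotientGroup.mk_surjective q
    change (QuotientGroup.mk (F τ) : OutOrd X) = _
    rw [mk_eq_mk_iff_equi]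
    intro x
    rw [hF]
    exact B.elt_equi _ _

end OrderAut

/-! ### Blocks as matrix algebras; from diagonal automorphisms to order automorphisms -/

section Matrices

variable {T R X : Type*} [CommRing T] [Ring R] [Algebra T R]
  [Preorder X] [LocallyFiniteOrder X] [DecidableEq X]

/-- `R_x` is the algebra of `n_x × n_x` matrices over `R`. -/
def rxEquivMatrix (x : X) : Rx T R x ≃ₗ[T] Matrix (Fin (nx x)) (Fin (nx x)) R where
  toFun f := Matrix.of fun i j =>
    f.1 ((blockEquiv x).symm i) ((blockEquiv x).symm j)
  map_add' _ _ := rfl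
  map_smul' _ _ := rfl
  invFun m :=
    ⟨⟨fun a b => if h : a ∈ Finset.Icc x x ∧ b ∈ Finset.Icc x x then
          m ((blockEquiv x) ⟨a, h.1⟩) ((blockEquiv x) ⟨b, h.2⟩) else 0,
        fun a b hab => dif_neg fun h =>
          hab ((Finset.mem_Icc.1 h.1).2.trans (Finset.mem_Icc.1 h.2).1)⟩,
      fun z y h => dif_neg fun h' => by
        rw [equi_iff_mem, equi_iff_mem] at h
        tauto⟩
  left_inv f := by
    ext a b _
    change (if h : a ∈ Finset.Icc x x ∧ b ∈ Finset.Icc x x then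
      f.1 ((blockEquiv x).symm ((blockEquiv x) ⟨a, h.1⟩))
        ((blockEquiv x).symm ((blockEquiv x) ⟨b, h.2⟩)) else 0) = _
    split_ifs with h
    · simp
    · refine (f.2 a b ?_).symm
      rw [equi_iff_mem, equi_iff_mem]
      tauto
  right_inv m := by
    ext i j
    refine (dif_pos ⟨Subtype.prop _, Subtype.prop _⟩).trans ?_
    simp

theorem rxEquivMatrix_apply (x : X) (f : Rx T R x) (i j : Fin (nx x)) :
    rxEquivMatrix x f i j = f.1 ((blockEquiv x).symm i) ((blockEquiv x).symm j) := rfl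

theorem rxEquivMatrix_mul (x : X) (f g : Rx T R x) :
    rxEquivMatrix x (f * g) = rxEquivMatrix x f * rxEquivMatrix x g := by
  ext i j
  rw [Matrix.mul_apply]
  have hi := Finset.mem_Icc.1 ((blockEquiv x).symm i).2
  have hj := Finset.mem_Icc.1 ((blockEquiv x).symm j).2
  -- The interval between any two elements of a class is the whole class, so convolution is the
  -- matrix product.
  have h : Finset.Icc ((blockEquiv x).symm i : X)
      ((blockEquiv x).symm j) = Finset.Icc x x := by
    ext z
    rw [Finset.mem_Icc, Finset.mem_Icc]
    exact ⟨fun h => ⟨hi.1.trans h.1, h.2.trans hj.2⟩, fun h => ⟨hi.2.trans h.1, h.2.trans hj.1⟩⟩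
  change (f.1 * g.1) _ _ = _
  rw [IncidenceAlgebra.mul_apply, h, ← Finset.sum_coe_sort]
  exact Fintype.sum_equiv (blockEquiv x) _ _ fun z => by simp [rxEquivMatrix_apply]

theorem nx_eq_of_RxIso (h12 : ConditionOne T R X ∨ NMCondition T R) {x y : X}
    (h : RxIso T R x y) : nx x = nx y := by
  rcases h12 with h1 | h2
  · exact h1 x y h
  · obtain ⟨i, hi⟩ := h
    refine h2 (nx x) (nx y) (nx_pos x) (nx_pos y) ⟨?_⟩
    let l : Rx T R x ≃ₗ[T] Rx T R y := { i with map_smul' := hi }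
    let k : Matrix (Fin (nx x)) (Fin (nx x)) R ≃ₗ[T] Matrix (Fin (nx y)) (Fin (nx y)) R :=
      (rxEquivMatrix x).symm.trans (l.trans (rxEquivMatrix y))
    have hk : ∀ a b, k (a * b) = k a * k b := by
      intro a b
      obtain ⟨a, rfl⟩ := (rxEquivMatrix (T := T) x).surjective a
      obtain ⟨b, rfl⟩ := (rxEquivMatrix (T := T) x).surjective b
      rw [← rxEquivMatrix_mul]
      simp only [k, LinearEquiv.trans_apply, LinearEquiv.symm_apply_apply]
      rw [← rxEquivMatrix_mul]
      exact congrArg _ (map_mul i a b)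
    refine AlgEquiv.ofLinearEquiv k ?_ hk
    -- `RxIso` is not required to respect identities; a multiplicative bijection does so
    -- automatically.
    have := hk 1 (k.symm 1)
    rwa [one_mul, LinearEquiv.apply_symm_apply, mul_one, eq_comm] at this

theorem RxIso_of_map_e {φ : AutK T R X} {x y : X} (h : φ (e R x) = e R y) : RxIso T R x y := by
  have h' : φ.symm (e R y) = e R x := by rw [← h, AlgEquiv.symm_apply_apply]
  have h1 : ∀ a ∈ Rx T R x, φ a ∈ Rx T R y := fun a ha => by
    rw [mem_Rx_iff, ← h, ← map_mul, ← map_mul, mem_Rx_iff.1 ha]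
  have h2 : ∀ a ∈ Rx T R y, φ.symm a ∈ Rx T R x := fun a ha => by
    rw [mem_Rx_iff, ← h', ← map_mul, ← map_mul, mem_Rx_iff.1 ha]
  exact ⟨{  toFun := fun a => ⟨φ a, h1 a a.2⟩
            invFun := fun a => ⟨φ.symm a, h2 a a.2⟩
            left_inv := fun a => Subtype.ext (φ.symm_apply_apply _)
            right_inv := fun a => Subtype.ext (φ.apply_symm_apply _)
            map_mul' := fun a b => Subtype.ext (map_mul φ a.1 b.1)
            map_add' := fun a b => Subtype.ext (map_add φ a.1 b.1) },
    fun t a => Subtype.ext (map_smul φ t a.1)⟩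

variable [Nontrivial R]

theorem le_of_map_e {φ : AutK T R X} {x y x' y' : X} (h : φ (e R x) = e R x')
    (h' : φ (e R y) = e R y') (hxy : x ≤ y) : x' ≤ y' := by
  rw [← exists_e_mul_mul_e_ne_zero_iff (R := R)] at hxy ⊢
  obtain ⟨f, hf⟩ := hxy
  refine ⟨φ f, ?_⟩
  rw [← h, ← h', ← map_mul, ← map_mul]
  exact (map_ne_zero_iff φ φ.injective).2 hf

/-- The index maps of `φ` and `φ⁻¹` on the `e_x` are monotone and inverse up to `∼`. Since `φ` maps
`R_x` isomorphically onto `R_{σ x}`, condition (1) or (2) gives equal class sizes, as lifting to `X`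
requires. -/
theorem exists_orderIso_of_mem_Lam (hII : ConditionII T R X)
    (h12 : ConditionOne T R X ∨ NMCondition T R) {φ : AutK T R X} (hφ : φ ∈ Lam T R X) :
    ∃ τ : X ≃o X, ∀ x, φ (e R x) = e R (τ x) := by
  choose σ hσ using exists_map_e_of_mem_Lam hII hφ
  choose σ' hσ' using exists_map_e_of_mem_Lam hII (inv_mem hφ)
  obtain ⟨B⟩ := nonempty_blockEnumeration X
  obtain ⟨τ, hτ⟩ := B.exists_orderIso (σ := σ) (σ' := σ')
    (fun x y h => le_of_map_e (hσ x) (hσ y) h) (fun x y h => le_of_map_e (hσ' x) (hσ' y) h)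
    (fun x => equi_of_e_eq (R := R) (by rw [← hσ, ← hσ', apply_inv_apply]))
    (fun x => equi_of_e_eq (R := R) (by rw [← hσ', ← hσ, inv_apply_apply]))
    (fun x => (nx_eq_of_RxIso h12 (RxIso_of_map_e (hσ x))).symm)
  exact ⟨τ, fun x => by rw [hσ, hτ, e_congr (B.elt_equi _ _)]⟩

theorem mem_Lam_of_orderIso {φ : AutK T R X} {τ : X ≃o X} (h : ∀ x, φ (e R x) = e R (τ x)) :
    φ ∈ Lam T R X :=
  mem_Lam_of (fun x => ⟨_, h x⟩)
    fun y => ⟨τ⁻¹ y, by rw [h, show τ (τ⁻¹ y) = y from τ.apply_symm_apply y]⟩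

end Matrices

end IncAut

/-! ### Internal semidirect products and their quotients -/

section Semidirect

theorem IsInternalSemidirect.of_forall {G : Type*} [Group G] {P N H : Subgroup G} (hN : N ≤ P)
    (hH : H ≤ P) (hnorm : ∀ g ∈ P, ∀ n ∈ N, g * n * g⁻¹ ∈ N)
    (hdisj : ∀ g ∈ N, g ∈ H → g = 1) (hmul : ∀ g ∈ P, ∃ n ∈ N, ∃ h ∈ H, n * h = g) :
    IsInternalSemidirect P N H where
  left_le := hN
  right_le := hH
  normal := ⟨fun n hn g => hnorm g g.2 n hn⟩
  inf_eq_bot := (Subgroup.eq_bot_iff_forall _).2 fun g hg => hdisj g hg.1 hg.2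
  mul_eq := by
    ext g
    refine ⟨?_, fun hg => ?_⟩
    · rintro ⟨n, hn, h, hh, rfl⟩
      exact mul_mem (hN hn) (hH hh)
    · obtain ⟨n, hn, h, hh, rfl⟩ := hmul g hg
      exact ⟨n, hn, h, hh, rfl⟩

theorem IsInternalSemidirect.sup_eq {G : Type*} [Group G] {P N H : Subgroup G}
    (h : IsInternalSemidirect P N H) : N ⊔ H = P := by
  refine le_antisymm (sup_le h.left_le h.right_le) fun g hg => ?_
  have hg' : g ∈ (N : Set G) * (H : Set G) := by rw [h.mul_eq]; exact hg
  obtain ⟨n, hn, k, hk, rfl⟩ := hg'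
  exact mul_mem (Subgroup.mem_sup_left hn) (Subgroup.mem_sup_right hk)

/-- If `G = N ⋊ P` and `P = C ⋊ Q`, then `G = N ⋊ C ⋊ Q`. -/
theorem IsInternalSemidirect.chain {G : Type*} [Group G] {N P C Q : Subgroup G}
    (h : IsInternalSemidirect ⊤ N P) (h' : IsInternalSemidirect P C Q) :
    IsInternalSemidirect (N ⊔ C) N C ∧ IsInternalSemidirect ⊤ (N ⊔ C) Q ∧
      IsInternalSemidirect ⊤ N (C ⊔ Q) := by
  have hN : N.Normal := ⟨fun n hn g => h.normal.conj_mem ⟨n, trivial⟩ hn ⟨g, trivial⟩⟩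
  have hNC : ∀ g, g ∈ N ⊔ C ↔ ∃ n ∈ N, ∃ c ∈ C, n * c = g := fun g => by
    rw [← SetLike.mem_coe, Subgroup.normal_mul]
    rfl
  have hNP : ∀ g, g ∈ N → g ∈ P → g = 1 := fun g h1 h2 =>
    Subgroup.mem_bot.1 (h.inf_eq_bot ▸ ⟨h1, h2⟩)
  have hCQ : ∀ g, g ∈ C → g ∈ Q → g = 1 := fun g h1 h2 =>
    Subgroup.mem_bot.1 (h'.inf_eq_bot ▸ ⟨h1, h2⟩)
  refine ⟨.of_forall le_sup_left le_sup_right (fun g _ n hn => hN.conj_mem n hn g)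
    (fun g h1 h2 => hNP g h1 (h'.left_le h2)) (fun g hg => (hNC g).1 hg),
    .of_forall le_top le_top ?_ ?_ ?_, by rwa [h'.sup_eq]⟩
  · have hC : ∀ p ∈ P, ∀ c ∈ C, p * c * p⁻¹ ∈ C := fun p hp c hc =>
      h'.normal.conj_mem ⟨c, h'.left_le hc⟩ hc ⟨p, hp⟩
    intro g _ x hx
    have hg : g ∈ (N : Set G) * (P : Set G) := by rw [h.mul_eq]; trivial
    obtain ⟨n, hn, p, hp, rfl⟩ := hg
    obtain ⟨m, hm, c, hc, rfl⟩ := (hNC x).1 hx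
    have h1 : p * (m * c) * p⁻¹ ∈ N ⊔ C :=
      (hNC _).2 ⟨p * m * p⁻¹, hN.conj_mem m hm p, p * c * p⁻¹, hC p hp c hc, by group⟩
    have hn' : n ∈ N ⊔ C := Subgroup.mem_sup_left hn
    have h2 := mul_mem (mul_mem hn' h1) (inv_mem hn')
    convert h2 using 1
    simp only [mul_inv_rev, mul_assoc]
  · intro g h1 h2
    obtain ⟨n, hn, c, hc, rfl⟩ := (hNC g).1 h1
    have h3 : n ∈ P := by
      have := mul_mem (h'.right_le h2) (inv_mem (h'.left_le hc))
      rwa [mul_inv_cancel_right] at this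
    rw [hNP n hn h3, one_mul] at h2 ⊢
    exact hCQ c hc h2
  · intro g _
    have hg : g ∈ (N : Set G) * (P : Set G) := by rw [h.mul_eq]; trivial
    obtain ⟨n, hn, p, hp, rfl⟩ := hg
    have hp' : p ∈ (C : Set G) * (Q : Set G) := by rw [h'.mul_eq]; exact hp
    obtain ⟨c, hc, q, hq, rfl⟩ := hp'
    exact ⟨n * c, (hNC _).2 ⟨n, hn, c, hc, rfl⟩, q, hq, mul_assoc _ _ _⟩

/-- The action of `Q` on `D` is conjugation by `b q` on the normal subgroup `a.range`, pulled back
along `a`. Hypothesis `hd` contains both the injectivity of `b` and the trivial intersection of the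
images. -/
theorem SemidirectProduct.exists_mulEquiv {H D Q : Type*} [Group H] [Group D] [Group Q]
    (a : D →* H) (b : Q →* H) (ha : Function.Injective a)
    (hn : a.range.Normal) (hd : ∀ d q, a d = b q → q = 1) (ht : ∀ h, ∃ d q, a d * b q = h) :
    ∃ (θ : Q →* MulAut D) (i : H ≃* D ⋊[θ] Q),
      (∀ d, i (a d) = SemidirectProduct.inl d) ∧ ∀ q, i (b q) = SemidirectProduct.inr q := by
  let A : D ≃* a.range := MonoidHom.ofInjective ha
  let θ : Q →* MulAut D :=
    (MulAut.congr A.symm).toMonoidHom.comp ((MulAut.conjNormal (H := a.range)).comp b)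
  have hθ : ∀ q d, a (θ q d) = b q * a d * (b q)⁻¹ := by
    intro q d
    have : A (θ q d) = MulAut.conjNormal (b q) (A d) := A.apply_symm_apply _
    have := congrArg Subtype.val this
    rwa [MulAut.conjNormal_apply] at this
  let F : D ⋊[θ] Q →* H := SemidirectProduct.lift a b fun q => by
    ext d
    exact hθ q d
  have hF : ∀ x, F x = a x.left * b x.right := fun x => rfl
  have hbij : Function.Bijective F := by
    refine ⟨(injective_iff_map_eq_one F).2 fun x hx => ?_, fun h => ?_⟩
    · rw [hF] at hx
      have h1 : x.right = 1 := by
        have := hd x.left x.right⁻¹ (by rw [map_inv]; exact eq_inv_of_mul_eq_one_left hx)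
        exact inv_eq_one.1 this
      rw [h1, map_one, mul_one] at hx
      exact SemidirectProduct.ext ((injective_iff_map_eq_one a).1 ha _ hx) h1
    · obtain ⟨d, q, rfl⟩ := ht h
      exact ⟨⟨d, q⟩, rfl⟩
  refine ⟨θ, (MulEquiv.ofBijective F hbij).symm, fun d => ?_, fun q => ?_⟩
  · rw [MulEquiv.symm_apply_eq]
    change a d = F _
    rw [hF, SemidirectProduct.left_inl, SemidirectProduct.right_inl, map_one, mul_one]
  · rw [MulEquiv.symm_apply_eq]
    change b q = F _
    rw [hF, SemidirectProduct.left_inr, SemidirectProduct.right_inr, map_one, one_mul]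

/-- If `G = (B C) ⋊ Q` with `B` normal in `G`, then `G / B ≅ D ⋊ Q` for every quotient `D` of `C`
by `B ∩ C`. -/
theorem IsInternalSemidirect.exists_quotient_mulEquiv {G Q D : Type*} [Group G] [Group Q]
    [Group D] {B C : Subgroup G} [B.Normal] {b : Q →* G}
    (h : IsInternalSemidirect ⊤ (B ⊔ C) b.range) (hb : Function.Injective b) (p : C →* D)
    (hp : Function.Surjective p) (hker : ∀ c : C, p c = 1 ↔ c.1 ∈ B) :
    ∃ (θ : Q →* MulAut D) (i : G ⧸ B ≃* D ⋊[θ] Q),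
      (∀ c : C, i (QuotientGroup.mk c.1) = SemidirectProduct.inl (p c)) ∧
        ∀ q, i (QuotientGroup.mk (b q)) = SemidirectProduct.inr q := by
  let g : C →* G ⧸ B := (QuotientGroup.mk' B).comp C.subtype
  have hg : ∀ c, g c = 1 ↔ c.1 ∈ B := fun c => QuotientGroup.eq_one_iff c.1
  -- The map `C → G / B` has the same kernel as `p`, so it factors through an injection of `D`,
  -- whose range is the image of `B C`.
  let a : D →* G ⧸ B := p.liftOfSurjective hp ⟨g, fun c hc => (hg c).2 ((hker c).1 hc)⟩
  have ha : ∀ c, a (p c) = g c := fun c =>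
    p.liftOfRightInverse_comp_apply _ _ ⟨g, fun c hc => (hg c).2 ((hker c).1 hc)⟩ c
  have hrange : a.range = (B ⊔ C).map (QuotientGroup.mk' B) := by
    rw [Subgroup.map_sup, QuotientGroup.map_mk'_self, bot_sup_eq]
    ext x
    constructor
    · rintro ⟨d, rfl⟩
      obtain ⟨c, rfl⟩ := hp d
      exact ⟨c, c.2, (ha c).symm⟩
    · rintro ⟨c, hc, rfl⟩
      exact ⟨p ⟨c, hc⟩, ha ⟨c, hc⟩⟩
  have hBC : (B ⊔ C).Normal := ⟨fun n hn x => h.normal.conj_mem ⟨n, trivial⟩ hn ⟨x, trivial⟩⟩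
  have hbBC : ∀ q, b q ∈ B ⊔ C → q = 1 := fun q hq => by
    refine (injective_iff_map_eq_one b).1 hb q (Subgroup.mem_bot.1 ?_)
    rw [← h.inf_eq_bot]
    exact ⟨hq, q, rfl⟩
  have key : ∀ d q, a d = QuotientGroup.mk' B (b q) → q = 1 := by
    intro d q hdq
    obtain ⟨c, rfl⟩ := hp d
    rw [ha] at hdq
    have h1 : c.1⁻¹ * b q ∈ B := QuotientGroup.eq.1 hdq
    refine hbBC q ?_
    have := mul_mem (Subgroup.mem_sup_right c.2) (Subgroup.mem_sup_left h1)
    rwa [mul_inv_cancel_left] at this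
  obtain ⟨θ, i, h1, h2⟩ := SemidirectProduct.exists_mulEquiv a ((QuotientGroup.mk' B).comp b)
    ((injective_iff_map_eq_one a).2 fun d hd => by
      obtain ⟨c, rfl⟩ := hp d
      rw [ha, hg] at hd
      exact (hker c).2 hd)
    (by rw [hrange]; exact hBC.map _ (QuotientGroup.mk'_surjective B))
    key
    (fun x => by
      obtain ⟨x, rfl⟩ := QuotientGroup.mk_surjective x
      have hx : x ∈ ((B ⊔ C : Subgroup G) : Set G) * (b.range : Set G) := by
        rw [h.mul_eq]; trivial
      obtain ⟨y, hy, _, ⟨q, rfl⟩, rfl⟩ := hx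
      have hy' : QuotientGroup.mk' B y ∈ a.range := by
        rw [hrange]
        exact ⟨y, hy, rfl⟩
      obtain ⟨d, hd⟩ := hy'
      exact ⟨d, q, by rw [hd]; rfl⟩)
  exact ⟨θ, i, fun c => by rw [← h1, ha]; rfl, h2⟩

end Semidirect

namespace IncAut

/-! ### Inner automorphisms against `Λ`, `C`, `Ψ` and the map `f` -/

section Main

variable {T R X : Type*} [CommRing T] [Ring R] [Algebra T R]
  [Preorder X] [LocallyFiniteOrder X] [DecidableEq X]

theorem coe_fHom_of_mem_Lam {φ : AutK T R X} (h : φ ∈ Lam T R X) (a : L T R X) :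
    (fHom T R X ⟨φ, h.2⟩ a : IncidenceAlgebra R X) = φ a :=
  congrArg Subtype.val (projL_coe T R X ⟨φ a, autPreserving_mem h.1 a.2⟩)

theorem fHom_eq_one_of_mem_In1 {φ : AutK T R X} (h : φ ∈ In1 T R X) (h' : φ ∈ Tri T R X) :
    fHom T R X ⟨φ, h'⟩ = 1 := by
  obtain ⟨u, hu, rfl⟩ := Subgroup.mem_map.1 h
  have key : ∀ v ∈ unitsOne T R X, projL T R X (v : IncidenceAlgebra R X) = 1 := fun v hv => by
    rw [← map_one (projL T R X), projL_eq_iff]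
    exact hv
  ext1 a
  rw [fHom_apply]
  change projL T R X (u * a * (u⁻¹ : (IncidenceAlgebra R X)ˣ)) = a
  rw [map_mul, map_mul, key u hu, key _ (inv_mem hu), one_mul, mul_one, projL_coe]

theorem In1_le_Inn : In1 T R X ≤ Inn T (IncidenceAlgebra R X) := Subgroup.map_le_range _ _

theorem In0_le_Inn : In0 T R X ≤ Inn T (IncidenceAlgebra R X) := Subgroup.map_le_range _ _

theorem exists_In1_mul_In0 {φ : AutK T R X} (h : φ ∈ Inn T (IncidenceAlgebra R X)) :
    ∃ i ∈ In1 T R X, ∃ j ∈ In0 T R X, i * j = φ := by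
  obtain ⟨u, rfl⟩ := h
  -- With `v` the `L`-component of `u`, the factor `u v⁻¹` has `L`-component `1`, that is, it lies
  -- in `1 + M`.
  let v : (L T R X)ˣ :=
    Units.map (projL T R X : IncidenceAlgebra R X →* L T R X) u
  refine ⟨innerAut T (u * (unitsIncl T R X v)⁻¹), Subgroup.mem_map_of_mem _ ?_,
    innerAut T (unitsIncl T R X v), Subgroup.mem_map_of_mem _ ⟨v, rfl⟩, ?_⟩
  · change (u : IncidenceAlgebra R X) * ((v⁻¹ : (L T R X)ˣ) : L T R X) - 1 ∈ M T R X
    rw [← projL_eq_iff, map_mul, projL_coe, map_one]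
    exact v.mul_inv
  · rw [← map_mul, inv_mul_cancel_right]

variable [Nontrivial R]

theorem In0_le_C : In0 T R X ≤ C T R X := by
  intro φ h
  obtain ⟨_, ⟨v, rfl⟩, rfl⟩ := Subgroup.mem_map.1 h
  refine mem_C_iff.2 fun x => ?_
  have h1 : (unitsIncl T R X v : IncidenceAlgebra R X) ∈ L T R X := v.1.2
  rw [innerAut_apply, ← e_mul_comm h1, Units.mul_inv_cancel_right]

theorem fHom_innerAut_unitsIncl (v : (L T R X)ˣ) (h : innerAut T (unitsIncl T R X v) ∈ Lam T R X) :
    fHom T R X ⟨_, h.2⟩ = innerAut T v := by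
  ext1 a
  exact Subtype.ext (coe_fHom_of_mem_Lam h a)

theorem Psi_le_C : Psi T R X ≤ C T R X := fun _ h => mem_C_iff.2 fun x => h.2 _ (e_mem_L x)

/-- Since `f` kills `In_1`, such a `φ` is the identity on `L`. Its defining unit `u` thus commutes
with every `e_x`, so `u ∈ L` and `u - 1 ∈ L ∩ M = 0`. -/
theorem mem_In1_inf_Lam {φ : AutK T R X} (h : φ ∈ In1 T R X) (h' : φ ∈ Lam T R X) : φ = 1 := by
  have h1 : ∀ a : L T R X, φ a = a := fun a => by
    rw [← coe_fHom_of_mem_Lam h', fHom_eq_one_of_mem_In1 h h'.2]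
    rfl
  obtain ⟨u, hu, rfl⟩ := Subgroup.mem_map.1 h
  have hL : (u : IncidenceAlgebra R X) ∈ L T R X := by
    refine mem_L_of_comm fun x => ?_
    have := h1 ⟨e R x, e_mem_L x⟩
    rw [innerAut_apply, Units.mul_inv_eq_iff_eq_mul] at this
    exact this.symm
  have h2 : (u : IncidenceAlgebra R X) = 1 :=
    sub_eq_zero.1 (eq_zero_of_mem_L_of_mem_M (T := T) (sub_mem hL (one_mem _)) hu)
  rw [Units.val_eq_one.1 h2, map_one]

theorem mem_Inn_iff_mem_In0 {c : AutK T R X} (hc : c ∈ Lam T R X) :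
    c ∈ Inn T (IncidenceAlgebra R X) ↔ c ∈ In0 T R X := by
  refine ⟨fun h => ?_, fun h => In0_le_Inn h⟩
  obtain ⟨i, hi, j, hj, rfl⟩ := exists_In1_mul_In0 h
  have h1 : i ∈ Lam T R X := by
    have := mul_mem hc (inv_mem (In0_le_C hj).1)
    rwa [mul_inv_cancel_right] at this
  rwa [mem_In1_inf_Lam hi h1, one_mul]

theorem mem_Psi_of_fHom_eq_one {φ : AutK T R X} (h : φ ∈ Lam T R X)
    (h1 : fHom T R X ⟨φ, h.2⟩ = 1) : φ ∈ Psi T R X :=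
  ⟨h, fun a ha => by
    have := coe_fHom_of_mem_Lam h ⟨a, ha⟩
    rw [h1] at this
    exact this.symm⟩

theorem mem_Psi_iff_fC {c : C T R X} : c.1 ∈ Psi T R X ↔ fC T R X c = 1 := by
  constructor
  · intro h
    refine Subtype.ext (AlgEquiv.ext fun a => Subtype.ext ?_)
    exact (coe_fHom_of_mem_Lam c.2.1 a).trans (h.2 a a.2)
  · intro h
    exact mem_Psi_of_fHom_eq_one c.2.1 (congrArg Subtype.val h)

theorem fC_mem_Inn_of_mem_In0 {c : C T R X} (h : c.1 ∈ In0 T R X) :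
    (fC T R X c).1 ∈ Inn T (L T R X) := by
  obtain ⟨c, hc⟩ := c
  obtain ⟨_, ⟨v, rfl⟩, rfl⟩ := Subgroup.mem_map.1 h
  exact ⟨v, (fHom_innerAut_unitsIncl v hc.1).symm⟩

/-- A unit of `L` inducing `f(c)` also defines an inner automorphism of `K` with the same image
under `f`; the quotient of `c` by it lies in the kernel `Ψ`. -/
theorem exists_In0_mul_Psi {c : C T R X} (h : (fC T R X c).1 ∈ Inn T (L T R X)) :
    ∃ i ∈ In0 T R X, ∃ ψ ∈ Psi T R X, i * ψ = c := by
  obtain ⟨v, hv⟩ := h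
  have hi : innerAut T (unitsIncl T R X v) ∈ In0 T R X := Subgroup.mem_map_of_mem _ ⟨v, rfl⟩
  have hC := In0_le_C hi
  refine ⟨_, hi, (innerAut T (unitsIncl T R X v))⁻¹ * c, ?_, mul_inv_cancel_left _ _⟩
  have h1 : fC T R X (⟨_, hC⟩⁻¹ * c) = 1 := by
    have h2 : fC T R X ⟨_, hC⟩ = fC T R X c :=
      Subtype.ext ((fHom_innerAut_unitsIncl v hC.1).trans hv)
    rw [map_mul, map_inv, h2, inv_mul_cancel]
  exact mem_Psi_iff_fC.2 h1

theorem mem_Inn_iff_mem_Psi0 {ψ : AutK T R X} (hψ : ψ ∈ Psi T R X) :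
    ψ ∈ Inn T (IncidenceAlgebra R X) ↔ ψ ∈ Psi0 T R X := by
  refine ⟨fun h => ?_, fun h => Subgroup.map_le_range _ _ h⟩
  rw [mem_Inn_iff_mem_In0 hψ.1] at h
  obtain ⟨_, ⟨v, rfl⟩, rfl⟩ := Subgroup.mem_map.1 h
  refine Subgroup.mem_map_of_mem _ (Subgroup.mem_map_of_mem _ ?_)
  -- Membership in the units of the center asks for centrality of both `v` and `v⁻¹`, so the claim
  -- is made for a general unit `w`.
  have key : ∀ w : (L T R X)ˣ, innerAut T (unitsIncl T R X w) ∈ Psi T R X →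
      (w : L T R X) ∈ Submonoid.center (L T R X) := by
    intro w hw
    refine Submonoid.mem_center_iff.2 fun a => ?_
    have h1 := hw.2 a a.2
    rw [innerAut_apply, Units.mul_inv_eq_iff_eq_mul] at h1
    exact Subtype.ext h1.symm
  exact ⟨key v hψ, key v⁻¹ (by rw [map_inv, map_inv]; exact inv_mem hψ)⟩

/-! ### Consequences of Condition (II): the decompositions of `Aut K`, `Λ`, `Ω` and `Out_0 K` -/

section CondII

theorem In1_normal (hII : ConditionII T R X) : (In1 T R X).Normal where
  conj_mem := by
    intro i hi φ
    obtain ⟨u, hu, rfl⟩ := Subgroup.mem_map.1 hi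
    rw [conj_innerAut]
    refine Subgroup.mem_map_of_mem _ ?_
    change φ u - 1 ∈ M T R X
    rw [← map_one φ, ← map_sub]
    exact map_mem_M hII φ hu

theorem top_eq_In1_Lam (hII : ConditionII T R X) :
    IsInternalSemidirect ⊤ (In1 T R X) (Lam T R X) :=
  .of_forall le_top le_top (fun g _ n hn => (In1_normal hII).conj_mem n hn g)
    (fun _ => mem_In1_inf_Lam) (fun g _ => exists_In1_mul_Lam hII g)

theorem exists_mem_Lam_of_mem_Om (hII : ConditionII T R X) {α : L T R X ≃ₐ[T] L T R X}
    (h : α ∈ Om T R X) : ∃ (φ : AutK T R X) (hφ : φ ∈ Lam T R X), fHom T R X ⟨φ, hφ.2⟩ = α := by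
  obtain ⟨⟨φ, hφ⟩, rfl⟩ := h
  obtain ⟨i, hi, ψ, hψ, rfl⟩ := exists_In1_mul_Lam hII φ
  refine ⟨ψ, hψ, ?_⟩
  have := map_mul (fHom T R X) ⟨i, mem_Tri hII i⟩ ⟨ψ, hψ.2⟩
  rw [fHom_eq_one_of_mem_In1 hi, one_mul] at this
  exact this.symm

theorem e_mem_Rx_iff {x y : X} : e R y ∈ Rx T R x ↔ Equi y x := by
  constructor
  · intro h
    by_contra hn
    have := h y y (Or.inl hn)
    rw [e_self] at this
    exact one_ne_zero this
  · intro h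
    rw [e_congr h]
    exact e_mem_Rx x

theorem map_e_mem_Rx_of_mem_Om1 {φ : AutK T R X} (hφ : φ ∈ Lam T R X)
    (h : fHom T R X ⟨φ, hφ.2⟩ ∈ Om1 T R X) (x : X) : φ (e R x) ∈ Rx T R x := by
  let a : L T R X := ⟨e R x, e_mem_L x⟩
  have h1 : a ∈ {a : L T R X | (a : IncidenceAlgebra R X) ∈ Rx T R x} :=
    e_mem_Rx (T := T) x
  have h2 : (fHom T R X ⟨φ, hφ.2⟩ a : IncidenceAlgebra R X) ∈ Rx T R x :=
    autPreserving_mem (Subgroup.mem_iInf.1 h.2 x) h1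
  rwa [coe_fHom_of_mem_Lam hφ] at h2

/-- A preimage `φ ∈ Λ` of `α ∈ Ω_1` sends `e_x` to some `e_y`; as `α` preserves `R_x`, this `e_y`
lies in `R_x`, so `y ∼ x` and `φ` fixes `e_x`. -/
theorem fC_surjective (hII : ConditionII T R X) : Function.Surjective (fC T R X) := by
  intro α
  obtain ⟨φ, hφ, h⟩ := exists_mem_Lam_of_mem_Om hII α.2.1
  refine ⟨⟨φ, mem_C_iff.2 fun x => ?_⟩, Subtype.ext h⟩
  have h1 := map_e_mem_Rx_of_mem_Om1 hφ (h ▸ α.2) x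
  obtain ⟨y, hy⟩ := exists_map_e_of_mem_Lam hII hφ x
  rw [hy, e_mem_Rx_iff] at h1
  rw [hy, e_congr h1]

theorem outToAutK_e (s : OutOrd X →* (X ≃o X)) (q : OutOrd X) (x : X) :
    outToAutK T R s q (e R x) = e R (s q x) := ordinal_e _ _

theorem outToAutK_mem_Lam (s : OutOrd X →* (X ≃o X)) (q : OutOrd X) :
    outToAutK T R s q ∈ Lam T R X := mem_Lam_of_orderIso (outToAutK_e s q)

theorem outToAutL_eq (s : OutOrd X →* (X ≃o X)) (q : OutOrd X) :
    outToAutL T R s q = fHom T R X ⟨outToAutK T R s q, (outToAutK_mem_Lam s q).2⟩ := rfl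

theorem eq_one_of_equi {s : OutOrd X →* (X ≃o X)} (hs : IsOutSection s) {q : OutOrd X}
    (h : ∀ x, Equi (s q x) x) : q = 1 := by
  rw [← hs q, ← QuotientGroup.mk_one, mk_eq_mk_iff_equi]
  exact h

/-- Gives at once the injectivity of `outToAutL` and the trivial intersection of its range with
`Ω_1`. -/
theorem eq_one_of_outToAutL_mem {s : OutOrd X →* (X ≃o X)} (hs : IsOutSection s) {q : OutOrd X}
    (h : outToAutL T R s q ∈ Om1 T R X) : q = 1 := by
  refine eq_one_of_equi hs fun x => ?_
  have := map_e_mem_Rx_of_mem_Om1 (outToAutK_mem_Lam s q) h x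
  rwa [outToAutK_e, e_mem_Rx_iff] at this

theorem outToAutL_injective {s : OutOrd X →* (X ≃o X)} (hs : IsOutSection s) :
    Function.Injective (outToAutL T R s) :=
  (injective_iff_map_eq_one _).2 fun _ h => eq_one_of_outToAutL_mem (T := T) (R := R) hs (by
    rw [h]
    exact one_mem _)

theorem eq_one_of_outToAutK_mem {s : OutOrd X →* (X ≃o X)} (hs : IsOutSection s) {q : OutOrd X}
    (h : outToAutK T R s q ∈ C T R X) : q = 1 := by
  refine eq_one_of_equi hs fun x => ?_
  have := mem_C_iff.1 h x
  rw [outToAutK_e] at this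
  exact equi_of_e_eq this

theorem outToAutK_injective {s : OutOrd X →* (X ≃o X)} (hs : IsOutSection s) :
    Function.Injective (outToAutK T R s) :=
  (injective_iff_map_eq_one _).2 fun _ h => eq_one_of_outToAutK_mem (T := T) (R := R) hs (by
    rw [h]
    exact one_mem _)

theorem exists_C_mul_outToAutK (hII : ConditionII T R X)
    (h12 : ConditionOne T R X ∨ NMCondition T R) {s : OutOrd X →* (X ≃o X)} (hs : IsOutSection s)
    {φ : AutK T R X} (hφ : φ ∈ Lam T R X) :
    ∃ c ∈ C T R X, ∃ q, c * outToAutK T R s q = φ := by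
  obtain ⟨τ, hτ⟩ := exists_orderIso_of_mem_Lam hII h12 hφ
  let q : OutOrd X := QuotientGroup.mk τ
  have hq : ∀ x, Equi (s q x) (τ x) := mk_eq_mk_iff_equi.1 (hs q)
  refine ⟨φ * (outToAutK T R s q)⁻¹, mem_C_iff.2 fun x => ?_, q, inv_mul_cancel_right _ _⟩
  rw [← map_inv, AlgEquiv.mul_apply, outToAutK_e, hτ]
  refine e_congr ((hq _).symm.trans ?_)
  rw [map_inv, show s q ((s q)⁻¹ x) = x from (s q).apply_symm_apply x]

theorem C_conj_mem (hII : ConditionII T R X) {φ c : AutK T R X} (hφ : φ ∈ Lam T R X)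
    (hc : c ∈ C T R X) : φ * c * φ⁻¹ ∈ C T R X := by
  refine mem_C_iff.2 fun x => ?_
  obtain ⟨y, hy⟩ := exists_map_e_of_mem_Lam hII (inv_mem hφ) x
  rw [AlgEquiv.mul_apply, AlgEquiv.mul_apply, hy, mem_C_iff.1 hc, ← hy, apply_inv_apply]

theorem Lam_eq_C_Out (hII : ConditionII T R X) (h12 : ConditionOne T R X ∨ NMCondition T R)
    {s : OutOrd X →* (X ≃o X)} (hs : IsOutSection s) :
    IsInternalSemidirect (Lam T R X) (C T R X) (outToAutK T R s).range := by
  refine .of_forall inf_le_left ?_ (fun _ hg _ hn => C_conj_mem hII hg hn) ?_ fun g hg => ?_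
  · rintro _ ⟨q, rfl⟩
    exact outToAutK_mem_Lam s q
  · rintro _ h ⟨q, rfl⟩
    rw [eq_one_of_outToAutK_mem hs h, map_one]
  · obtain ⟨c, hc, q, rfl⟩ := exists_C_mul_outToAutK hII h12 hs hg
    exact ⟨c, hc, _, ⟨q, rfl⟩, rfl⟩

theorem Om_eq_Om1_Out (hII : ConditionII T R X) (h12 : ConditionOne T R X ∨ NMCondition T R)
    {s : OutOrd X →* (X ≃o X)} (hs : IsOutSection s) :
    IsInternalSemidirect (Om T R X) (Om1 T R X) (outToAutL T R s).range := by
  refine .of_forall inf_le_left ?_ (fun g hg n hn => ?_) ?_ fun g hg => ?_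
  · rintro _ ⟨q, rfl⟩
    exact ⟨_, (outToAutL_eq s q).symm⟩
  · obtain ⟨φ, hφ, rfl⟩ := exists_mem_Lam_of_mem_Om hII hg
    obtain ⟨c, hc⟩ := fC_surjective hII ⟨n, hn⟩
    have h1 : fHom T R X ⟨c, c.2.1.2⟩ = n := congrArg Subtype.val hc
    rw [← h1, ← map_inv, ← map_mul, ← map_mul]
    exact (fC T R X ⟨_, C_conj_mem hII hφ c.2⟩).2
  · rintro _ h ⟨q, rfl⟩
    rw [eq_one_of_outToAutL_mem hs h, map_one]
  · obtain ⟨φ, hφ, rfl⟩ := exists_mem_Lam_of_mem_Om hII hg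
    obtain ⟨c, hc, q, rfl⟩ := exists_C_mul_outToAutK hII h12 hs hφ
    refine ⟨fHom T R X ⟨c, hc.1.2⟩, (fC T R X ⟨c, hc⟩).2, outToAutL T R s q, ⟨q, rfl⟩, ?_⟩
    rw [outToAutL_eq, ← map_mul]
    rfl

theorem Inn_sup_C : Inn T (IncidenceAlgebra R X) ⊔ C T R X = In1 T R X ⊔ C T R X := by
  refine le_antisymm (sup_le (fun φ h => ?_) le_sup_right) (sup_le_sup_right In1_le_Inn _)
  obtain ⟨i, hi, j, hj, rfl⟩ := exists_In1_mul_In0 h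
  exact mul_mem (Subgroup.mem_sup_left hi) (Subgroup.mem_sup_right (In0_le_C hj))

theorem Inn_sup_Psi (h : Om1 T R X = Inn T (L T R X)) :
    Inn T (IncidenceAlgebra R X) ⊔ Psi T R X = Inn T (IncidenceAlgebra R X) ⊔ C T R X := by
  refine le_antisymm (sup_le_sup_left Psi_le_C _) (sup_le le_sup_left fun c hc => ?_)
  obtain ⟨i, hi, ψ, hψ, h2⟩ := exists_In0_mul_Psi (c := ⟨c, hc⟩) (h ▸ (fC T R X ⟨c, hc⟩).2)
  rw [← show i * ψ = c from h2]
  exact mul_mem (Subgroup.mem_sup_left (In0_le_Inn hi)) (Subgroup.mem_sup_right hψ)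

theorem mk_fC_eq_one_iff {c : C T R X} :
    (QuotientGroup.mk (fC T R X c) : Om1Quot T R X) = 1 ↔
      ∃ i ∈ In0 T R X, ∃ ψ ∈ Psi T R X, i * ψ = c := by
  rw [QuotientGroup.eq_one_iff, Subgroup.mem_subgroupOf]
  refine ⟨exists_In0_mul_Psi, ?_⟩
  rintro ⟨i, hi, ψ, hψ, h⟩
  have h1 : c = ⟨i, In0_le_C hi⟩ * ⟨ψ, Psi_le_C hψ⟩ := Subtype.ext h.symm
  have h2 : fC T R X ⟨ψ, Psi_le_C hψ⟩ = 1 := mem_Psi_iff_fC.1 hψ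
  rw [h1, map_mul, h2, mul_one]
  exact fC_mem_Inn_of_mem_In0 hi

/-- `F` is the kernel of the map `Out_0 K → Ω_1 / In(Aut L)` induced by `f`. It equals `In_0 Ψ /
In_0`, which is `Ψ / (Ψ ∩ In_0) = Ψ / Ψ_0`. -/
theorem exists_normal_Out0 (hII : ConditionII T R X) :
    ∃ (F : Subgroup (Out0 T R X)) (_ : F.Normal),
      Nonempty (F ≃* PsiQuot T R X) ∧ Nonempty (Out0 T R X ⧸ F ≃* Om1Quot T R X) := by
  let p : Out0 T R X →* Om1Quot T R X :=
    QuotientGroup.map _ _ (fC T R X) fun c hc => fC_mem_Inn_of_mem_In0 hc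
  have hp : Function.Surjective p := by
    intro y
    obtain ⟨α, rfl⟩ := QuotientGroup.mk_surjective y
    obtain ⟨c, rfl⟩ := fC_surjective hII α
    exact ⟨QuotientGroup.mk c, rfl⟩
  let g : Psi T R X →* p.ker :=
    ((QuotientGroup.mk' _).comp (Subgroup.inclusion Psi_le_C)).codRestrict p.ker fun ψ =>
      mk_fC_eq_one_iff.2 ⟨1, one_mem _, ψ, ψ.2, one_mul _⟩
  have hg : Function.Surjective g := by
    rintro ⟨y, hy⟩
    obtain ⟨c, rfl⟩ := QuotientGroup.mk_surjective y
    obtain ⟨i, hi, ψ, hψ, h⟩ := mk_fC_eq_one_iff.1 hy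
    refine ⟨⟨ψ, hψ⟩, Subtype.ext (QuotientGroup.eq.2 ?_)⟩
    change ψ⁻¹ * c.1 ∈ In0 T R X
    -- With `c = i ψ` the element becomes `ψ⁻¹ i ψ`, a conjugate of `i ∈ In_0` by an element of `C`.
    rw [← h, ← mul_assoc]
    have := conj_mem_In0 T R X (inv_mem (Psi_le_C hψ)) hi
    rwa [inv_inv] at this
  have hker : (Psi0 T R X).subgroupOf (Psi T R X) = g.ker := by
    ext ψ
    have h1 : g ψ = 1 ↔
        (QuotientGroup.mk (Subgroup.inclusion Psi_le_C ψ) : Out0 T R X) = 1 := Subtype.ext_iff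
    rw [MonoidHom.mem_ker, h1, QuotientGroup.eq_one_iff, Subgroup.mem_subgroupOf,
      Subgroup.mem_subgroupOf, ← mem_Inn_iff_mem_Psi0 ψ.2, mem_Inn_iff_mem_In0 ψ.2.1]
    rfl
  exact ⟨p.ker, inferInstance,
    ⟨((QuotientGroup.quotientMulEquivOfEq hker).trans
      (QuotientGroup.quotientKerEquivOfSurjective g hg)).symm⟩,
    ⟨QuotientGroup.quotientKerEquivOfSurjective p hp⟩⟩

end CondII

end Main

end IncAut
end

open IncAut
theorem theorem9p1 {T R X : Type*} [CommRing T] [Ring R] [Nontrivial R] [Algebra T R]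
    [Preorder X] [LocallyFiniteOrder X] [DecidableEq X]
    (hII : ConditionII T R X)
    (h12 : ConditionOne T R X ∨ NMCondition T R) :
    -- `Out X` can be embedded in `Aut X` as a complement of `In(Aut X)`
    (∃ s : OutOrd X →* (X ≃o X), IsOutSection s) ∧
    -- and for every such embedding:
    (∀ s : OutOrd X →* (X ≃o X), IsOutSection s →
      -- `Ω = Ω_1 ⋊ Out X`
      (Function.Injective (outToAutL T R s) ∧
        IsInternalSemidirect (Om T R X) (Om1 T R X) (outToAutL T R s).range) ∧
      -- `Λ = C ⋊ Out X`
      (Function.Injective (outToAutK T R s) ∧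
        IsInternalSemidirect (Lam T R X) (C T R X) (outToAutK T R s).range) ∧
      -- `Aut K = In_1(Aut K) ⋊ C ⋊ Out X`, with either bracketing
      (IsInternalSemidirect (In1 T R X ⊔ C T R X) (In1 T R X) (C T R X) ∧
        IsInternalSemidirect ⊤ (In1 T R X ⊔ C T R X) (outToAutK T R s).range ∧
        IsInternalSemidirect ⊤ (In1 T R X) (C T R X ⊔ (outToAutK T R s).range)) ∧
      -- `Out K ≅ Out_0 K ⋊ Out X`
      (∃ (θ : OutOrd X →* MulAut (Out0 T R X))
        (i : OutAlg T (IncidenceAlgebra R X) ≃* Out0 T R X ⋊[θ] OutOrd X),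
        (∀ c : C T R X,
          i (QuotientGroup.mk c.1) = SemidirectProduct.inl (QuotientGroup.mk c)) ∧
        (∀ q : OutOrd X,
          i (QuotientGroup.mk (outToAutK T R s q)) = SemidirectProduct.inr q)) ∧
      -- if `Ψ = Ψ_0`, then `Out K ≅ Ω_1/In(Aut L) ⋊ Out X`
      (Psi T R X = Psi0 T R X →
        ∃ (θ : OutOrd X →* MulAut (Om1Quot T R X))
          (i : OutAlg T (IncidenceAlgebra R X) ≃* Om1Quot T R X ⋊[θ] OutOrd X),
          (∀ c : C T R X,
            i (QuotientGroup.mk c.1) = SemidirectProduct.inl (QuotientGroup.mk (fC T R X c))) ∧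
          (∀ q : OutOrd X,
            i (QuotientGroup.mk (outToAutK T R s q)) = SemidirectProduct.inr q)) ∧
      -- if `Ω_1 = In(Aut L)`, then `Out K ≅ Ψ/Ψ_0 ⋊ Out X`
      (Om1 T R X = Inn T (L T R X) →
        ∃ (θ : OutOrd X →* MulAut (PsiQuot T R X))
          (i : OutAlg T (IncidenceAlgebra R X) ≃* PsiQuot T R X ⋊[θ] OutOrd X),
          (∀ ψ : Psi T R X,
            i (QuotientGroup.mk ψ.1) = SemidirectProduct.inl (QuotientGroup.mk ψ)) ∧
          (∀ q : OutOrd X,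
            i (QuotientGroup.mk (outToAutK T R s q)) = SemidirectProduct.inr q))) ∧
    -- `Out_0 K` has a normal subgroup `F ≅ Ψ/Ψ_0` with `Out_0 K / F ≅ Ω_1/In(Aut L)`
    (∃ (F : Subgroup (Out0 T R X)) (_ : F.Normal),
      Nonempty (F ≃* PsiQuot T R X) ∧ Nonempty (Out0 T R X ⧸ F ≃* Om1Quot T R X)) := by
  have hII' := top_eq_In1_Lam hII
  refine ⟨exists_outSection X, fun s hs => ?_, exists_normal_Out0 hII⟩
  have hchain := hII'.chain (Lam_eq_C_Out hII h12 hs)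
  have hInn : IsInternalSemidirect ⊤ (Inn T (IncidenceAlgebra R X) ⊔ C T R X)
      (outToAutK T R s).range := by
    rw [Inn_sup_C]
    exact hchain.2.1
  have hinj := outToAutK_injective (T := T) (R := R) hs
  refine ⟨⟨outToAutL_injective hs, Om_eq_Om1_Out hII h12 hs⟩,
    ⟨hinj, Lam_eq_C_Out hII h12 hs⟩, hchain, ?_, fun hΨ => ?_, fun hΩ => ?_⟩
  · refine hInn.exists_quotient_mulEquiv hinj (QuotientGroup.mk' _)
      (QuotientGroup.mk'_surjective _) fun c => ?_
    rw [mem_Inn_iff_mem_In0 c.2.1]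
    exact QuotientGroup.eq_one_iff c
  · refine hInn.exists_quotient_mulEquiv hinj ((QuotientGroup.mk' _).comp (fC T R X))
      ((QuotientGroup.mk'_surjective _).comp (fC_surjective hII)) fun c => ?_
    refine mk_fC_eq_one_iff.trans ?_
    rw [mem_Inn_iff_mem_In0 c.2.1]
    constructor
    · rintro ⟨i, hi, ψ, hψ, h⟩
      rw [← h]
      -- The kernel of `C → Ω_1 / In(Aut L)` is `In_0 Ψ`, which collapses to `In_0` because `Ψ =
      -- Ψ_0` is inner.
      refine mul_mem hi ((mem_Inn_iff_mem_In0 hψ.1).1 ((mem_Inn_iff_mem_Psi0 hψ).2 ?_))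
      exact hΨ ▸ hψ
    · exact fun h => ⟨c, h, 1, one_mem _, mul_one _⟩
  -- When `Ω_1 = In(Aut L)`, every element of `C` lies in `In_0 Ψ`, so `Ψ` can take the place of `C`
  -- in the quotient.
  · rw [← Inn_sup_Psi hΩ] at hInn
    refine hInn.exists_quotient_mulEquiv hinj (QuotientGroup.mk' _)
      (QuotientGroup.mk'_surjective _) fun ψ => ?_
    rw [mem_Inn_iff_mem_Psi0 ψ.2]
    exact QuotientGroup.eq_one_iff ψ
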